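/- Let $c_0,c_1>0$ and $p_0,p_1\in(0,1)$. For every $\Delta>0$ with $c_0\Delta<1$ and $c_1\Delta<1$, let $(Y_t)_{t\in\mathbb N}$ be a $\{-1,1\}$-valued Markov chain of order $2$ such that the Markov chain $(Y_t,Y_{t+1})_{t\ge 0}$ on the states $(-1,-1),(-1,1),(1,-1),(1,1)$ (in this order) has the transition matrix $$\pi^\Delta=\begin{pmatrix}1-c_0\Delta & c_0\Delta & 0 & 0\\ 0&0&1-p_0&p_0\\ p_1&1-p_1&0&0\\ 0&0&c_1\Delta&1-c_1\Delta\end{pmatrix}.$$ Put $X_t=\sum_{i=0}^t Y_i$, and let $(\tilde Z^\Delta_s)_{s\ge 0}$ be the continuous linear interpolation of $Z^\Delta_s=\Delta X_{s/\Delta}$, $s\in\Delta\mathbb N$. For $i=0,1$ put $$v_i=\frac{p_i}{1-(1-p_0)(1-p_1)},\qquad c_i'=c_iv_i .$$ For $a,b>0$ and independent exponential random variables $e_1,e_2,\dots$ of mean $1$, put $$N^{a,b}_t=\sum_{k\ge1}\mathbf 1_{\{\lambda_1e_1+\dots+\lambda_ke_k\le t\}},\qquad \lambda_k=\begin{cases}1/a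 & k\text{ odd}\\ 1/b & k\text{ even,}\end{cases}\qquad Z^{a,b}_t=\int_0^t(-1)^{N^{a,b}_u}\,du .$$ All convergences below are in distribution on $C([0,\infty),\mathbb R)$ with the topology of uniform convergence on compact sets, as $\Delta\to0$. 1) If $Y_0=Y_1=-1$ almost surely for every $\Delta$, then $(\tilde Z^\Delta_s)_{s\ge0}$ converges to $(-Z^{c_0',c_1'}_s)_{s\ge0}$. If $Y_0=Y_1=1$ almost surely for every $\Delta$, then it converges to $(Z^{c_1',c_0'}_s)_{s\ge0}$. 2) If $Y_0=1$ and $Y_1=-1$ almost surely for every $\Delta$ (resp. $Y_0=-1$ and $Y_1=1$ almost surely for every $\Delta$), then $(\tilde Z^\Delta_s)_{s\ge0}$ converges to $$\Big((\epsilon-1)\int_0^s(-1)^{N^{c_0',c_1'}_u}\,du+\epsilon\int_0^s(-1)^{N^{c_1',c_0'}_u}\,du\Big)_{s\ge0},$$ where $\epsilon$ is a $\{0,1\}$-valued random variable with $\mathbb P(\epsilon=0)=1-\mathbb P(\epsilon=1)=v_1$ (resp. $\mathbb P(\epsilon=1)=1-\mathbb P(\epsilon=0)=v_0$). Here $N^{c_0',c_1'}$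 and $N^{c_1',c_0'}$ are built from two sequences of independent exponential variables of mean $1$, which may be the same sequence or depend on each other in any way, and $\epsilon$ is independent of each of these two sequences. -/

import Mathlib

open MeasureTheory ProbabilityTheory Filter Topology
open scoped NNReal

/-- The path space `C([0,∞), ℝ)` (topology of uniform convergence on compact sets) carries its
Borel σ-algebra. -/
instance pathMeasurableSpace : MeasurableSpace C(ℝ≥0, ℝ) := borel _

instance pathBorelSpace : BorelSpace C(ℝ≥0, ℝ) := ⟨rfl⟩

/-! ### The order-two chain and the interpolated walk -/

/-- The four states of the pair chain `(Y_t, Y_{t+1})`, in the order in which they index the rows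
and columns of the transition matrix. -/
def pairState : Fin 4 → ℤ × ℤ := ![(-1, -1), (-1, 1), (1, -1), (1, 1)]

/-- The transition matrix of the pair chain. -/
def pairMatrix (c₀ c₁ p₀ p₁ δ : ℝ) : Matrix (Fin 4) (Fin 4) ℝ :=
  !![1 - c₀ * δ, c₀ * δ, 0, 0;
     0, 0, 1 - p₀, p₀;
     p₁, 1 - p₁, 0, 0;
     0, 0, c₁ * δ, 1 - c₁ * δ]

/-- `Y` is a `{-1,1}`-valued Markov chain of order two: the pair process `(Y_t, Y_{t+1})` is a
Markov chain with transition matrix `M` (rows and columns indexed through `pairState`). The Markov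
property is stated on cylinder events, in product form. -/
structure IsOrderTwoChain {Ω : Type*} [MeasurableSpace Ω] (M : Matrix (Fin 4) (Fin 4) ℝ)
    (Y : ℕ → Ω → ℤ) (P : Measure Ω) : Prop where
  measurable : ∀ t, Measurable (Y t)
  mem : ∀ t ω, Y t ω = -1 ∨ Y t ω = 1
  markov : ∀ (n : ℕ) (x : ℕ → Fin 4),
    P.real {ω | ∀ t ≤ n + 1, (Y t ω, Y (t + 1) ω) = pairState (x t)} =
      P.real {ω | ∀ t ≤ n, (Y t ω, Y (t + 1) ω) = pairState (x t)} * M (x n) (x (n + 1))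

/-- The time steps `δ > 0` for which `c₀ δ < 1` and `c₁ δ < 1`. -/
def StepSize (c₀ c₁ : ℝ) : Type := {δ : ℝ // 0 < δ ∧ c₀ * δ < 1 ∧ c₁ * δ < 1}

/-- The filter `δ → 0` on the admissible time steps. -/
def stepToZero (c₀ c₁ : ℝ) : Filter (StepSize c₀ c₁) := comap Subtype.val (𝓝 (0 : ℝ))

/-- The walk `X_t = Y_0 + ⋯ + Y_t`. -/
def walk (y : ℕ → ℤ) (t : ℕ) : ℝ := ∑ i ∈ Finset.range (t + 1), (y i : ℝ)

/-- Linear interpolation of a sequence: on `[n, n+1]` the affine function with values `x n` and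
`x (n+1)` at the end points. -/
noncomputable def interp (x : ℕ → ℝ) (u : ℝ) : ℝ :=
  x ⌊u⌋₊ + (u - ⌊u⌋₊) * (x (⌊u⌋₊ + 1) - x ⌊u⌋₊)

theorem interp_eq_of_mem (x : ℕ → ℝ) (n : ℕ) {u : ℝ} (hu : u ∈ Set.Icc (n : ℝ) (n + 1)) :
    interp x u = x n + (u - n) * (x (n + 1) - x n) := by
  rcases hu.2.lt_or_eq with h | h
  · have : ⌊u⌋₊ = n := (Nat.floor_eq_iff (n.cast_nonneg.trans hu.1)).2 ⟨hu.1, h⟩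
    simp [interp, this]
  · have : ⌊u⌋₊ = n + 1 := by
      rw [h]
      exact_mod_cast Nat.floor_natCast (R := ℝ) (n + 1)
    rw [interp, this, h]
    push_cast
    ring

theorem continuous_interp (x : ℕ → ℝ) : Continuous (interp x) := by
  have key : ∀ n : ℕ, ContinuousOn (interp x) (Set.Iic (n : ℝ)) := by
    intro n
    induction n with
    | zero =>
      have h0 : ContinuousOn (fun u : ℝ => x 0 + u * (x 1 - x 0)) (Set.Iic ((0 : ℕ) : ℝ)) := by
        fun_prop
      refine h0.congr fun u hu => ?_
      have : ⌊u⌋₊ = 0 := Nat.floor_of_nonpos (by simpa using hu)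
      simp [interp, this]
    | succ n ih =>
      have h1 : ContinuousOn (interp x) (Set.Icc (n : ℝ) (n + 1)) := by
        have h0 : ContinuousOn (fun u : ℝ => x n + (u - n) * (x (n + 1) - x n))
            (Set.Icc (n : ℝ) (n + 1)) := by fun_prop
        exact h0.congr fun u hu => interp_eq_of_mem x n hu
      have h2 := ih.union_of_isClosed h1 isClosed_Iic isClosed_Icc
      rwa [Set.Iic_union_Icc_eq_Iic (by linarith), ← Nat.cast_succ] at h2
  refine continuous_iff_continuousAt.2 fun u => ?_
  obtain ⟨n, hn⟩ := exists_nat_gt u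
  exact (key n).continuousAt (Iic_mem_nhds hn)

/-- The rescaled interpolated walk: the linear interpolation of `s ↦ δ X_{s/δ}`, `s ∈ δ ℕ`. -/
noncomputable def interpWalk (δ : ℝ) (y : ℕ → ℤ) : C(ℝ≥0, ℝ) where
  toFun s := δ * interp (walk y) (s / δ)
  continuous_toFun := by
    have := continuous_interp (walk y)
    fun_prop

/-! ### The integrated telegraph noise -/

/-- The `n`-th jump time `λ₁ e₁ + ⋯ + λₙ eₙ` of the counting process, where `λₖ = 1/a` for odd `k`
and `λₖ = 1/b` for even `k`. The term `e k` of the sequence is the variable `e_{k+1}`. -/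
noncomputable def jumpTime (a b : ℝ) (e : ℕ → ℝ) (n : ℕ) : ℝ :=
  ∑ k ∈ Finset.range n, (if Even k then 1 / a else 1 / b) * e k

/-- The counting process `N_t^{a,b}`: the number of `k ≥ 1` with `λ₁ e₁ + ⋯ + λₖ eₖ ≤ t`. -/
noncomputable def countingProcess (a b : ℝ) (e : ℕ → ℝ) (t : ℝ) : ℕ :=
  Set.ncard {k : ℕ | 1 ≤ k ∧ jumpTime a b e k ≤ t}

theorem measurable_countingProcess (a b : ℝ) (e : ℕ → ℝ) :
    Measurable (countingProcess a b e) := by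
  refine measurable_ncard.comp (measurable_set_iff.2 fun k => ?_)
  refine Measurable.and measurable_const ?_
  exact measurableSet_setOfPred.1 measurableSet_Ici

/-- The integrated telegraph noise `Z_t^{a,b} = ∫₀ᵗ (-1)^{N_u^{a,b}} du`. -/
noncomputable def telegraph (a b : ℝ) (e : ℕ → ℝ) : C(ℝ≥0, ℝ) where
  toFun t := ∫ u in (0 : ℝ)..t, (-1 : ℝ) ^ countingProcess a b e u
  continuous_toFun := by
    have hm : Measurable fun u : ℝ => (-1 : ℝ) ^ countingProcess a b e u :=
      (Measurable.of_discrete (f := fun n : ℕ => (-1 : ℝ) ^ n)).comp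
        (measurable_countingProcess a b e)
    have hi : ∀ r s : ℝ, IntervalIntegrable (fun u : ℝ => (-1 : ℝ) ^ countingProcess a b e u)
        volume r s := fun r s =>
      (intervalIntegrable_const (c := (1 : ℝ))).mono_fun hm.aestronglyMeasurable
        (Eventually.of_forall fun u => by simp)
    exact (intervalIntegral.continuous_primitive hi 0).comp NNReal.continuous_coe

/-- `e` is a sequence of independent exponential random variables of mean one. -/
structure IsStdExpSequence {Ω : Type*} [MeasurableSpace Ω] (e : ℕ → Ω → ℝ) (P : Measure Ω) :
    Prop where
  hasLaw : ∀ k, HasLaw (e k) (expMeasure 1) P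
  indep : iIndepFun e P

/-- The absorption probability `v = p / (1 - (1 - p₀)(1 - p₁))`, to be used with `p = p₀, p₁`. -/
noncomputable def absorb (p₀ p₁ p : ℝ) : ℝ := p / (1 - (1 - p₀) * (1 - p₁))

/-! The pair chain has two time scales. In the slow states `(-1,-1)` and `(1,1)` the walk moves with
constant velocity and leaves with probability of order `δ`. In the alternating states it oscillates
and is absorbed into a slow state within `O(1)` steps, hence within time `O(δ)`. First-step analysis
shows that an excursion from `(-1,1)` ends in `(1,1)` with probability `v₀`, and one from `(1,-1)`
ends in `(-1,-1)` with probability `v₁`. Only excursions that change the velocity are visible in the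
limit, so the jump rates are thinned to `c₀ v₀` and `c₁ v₁`. Started in an alternating state, the
walk picks its first macroscopic velocity through one such excursion.

The proof compares expectations. All paths are Lipschitz, so they live in a compact set. By
Stone-Weierstrass it is enough to test with functionals `F` that are Lipschitz for the uniform
distance on some `[0, T]`. A path run for one step of length `δ` and then continued is a `glue`, and
composing `F` with `glue` shortens its horizon by `δ`. This allows an induction on the number of
steps.

The expectations of the walk satisfy an exact recursion (`IsOrderTwoChain.abs_integral_sub_le`, the
Markov property). By the memoryless property of the first jump, `telegraphMean` satisfies the
recursion of a two-state chain up to `O(δ ^ 2)` (`abs_telegraphMean_sub_le`). Mixing with the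
absorption probabilities makes `pairMean` an approximate solution of the recursion of the walk
(`abs_pairMean_sub_le`): the defect is `O(δ ^ 2)` in the slow states and `O(δ)` in the alternating
ones. The larger defects do not accumulate, since excursions are short and start with probability
`O(δ)`. After about `T / δ` steps the total error is `O(δ)` (`abs_integral_centeredWalk_sub_le`). -/

/-! ### Test functionals on the path space -/

/-- The paths that are `1`-Lipschitz and start at distance at most `r` from the origin. -/
def lipPaths (r : ℝ) : Set C(ℝ≥0, ℝ) :=
  {f | |f 0| ≤ r ∧ ∀ s t : ℝ≥0, |f s - f t| ≤ |(s : ℝ) - t|}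

/-- Arzelà-Ascoli. The defining inequalities are closed under pointwise convergence and confine the
value at `s` to `[-(r + s), r + s]`, so Tychonoff gives pointwise compactness. The common Lipschitz
constant gives equicontinuity. -/
theorem isCompact_lipPaths (r : ℝ) : IsCompact (lipPaths r) := by
  refine ArzelaAscoli.isCompact_of_equicontinuous _ ?_ ?_
  · have himage : ContinuousMap.toFun '' lipPaths r =
        {g : ℝ≥0 → ℝ | |g 0| ≤ r ∧ ∀ s t : ℝ≥0, |g s - g t| ≤ |(s : ℝ) - t|} := by
      ext g
      constructor
      · rintro ⟨f, hf, rfl⟩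
        exact hf
      · intro hg
        have hl : LipschitzWith 1 g := LipschitzWith.of_dist_le_mul fun s t => by
          simpa [Real.dist_eq, NNReal.dist_eq] using hg.2 s t
        exact ⟨⟨g, hl.continuous⟩, hg, rfl⟩
    rw [himage]
    refine IsCompact.of_isClosed_subset
      (isCompact_univ_pi fun s : ℝ≥0 => isCompact_Icc (a := -(r + s)) (b := r + s)) ?_ ?_
    · have h0 : IsClosed {g : ℝ≥0 → ℝ | |g 0| ≤ r} := isClosed_le (by fun_prop) continuous_const
      have h1 : IsClosed (⋂ (s : ℝ≥0) (t : ℝ≥0), {g : ℝ≥0 → ℝ | |g s - g t| ≤ |(s : ℝ) - t|}) :=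
        isClosed_iInter fun s => isClosed_iInter fun t =>
          isClosed_le (by fun_prop) continuous_const
      convert h0.inter h1 using 1
      ext g
      simp
    · intro g hg s _
      have h1 := hg.2 s 0
      have h2 := hg.1
      simp only [NNReal.coe_zero, sub_zero, NNReal.abs_eq] at h1
      rw [abs_le] at h1 h2
      constructor <;> linarith [h1.1, h1.2, h2.1, h2.2]
  · refine UniformEquicontinuous.equicontinuous ?_
    refine LipschitzWith.uniformEquicontinuous (K := 1) _ fun f => ?_
    refine LipschitzWith.of_dist_le_mul fun s t => ?_
    simpa [Real.dist_eq, NNReal.dist_eq] using f.2.2 s t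

/-- `F` is Lipschitz with constant `L` for the uniform distance of paths on `[0, T]`. -/
def HorizonLip (T L : ℝ) (F : C(ℝ≥0, ℝ) → ℝ) : Prop :=
  ∀ (f g : C(ℝ≥0, ℝ)) (r : ℝ), (∀ s : ℝ≥0, (s : ℝ) ≤ T → |f s - g s| ≤ r) → |F f - F g| ≤ L * r

theorem HorizonLip.mono {T T' L L' : ℝ} {F : C(ℝ≥0, ℝ) → ℝ} (hF : HorizonLip T L F)
    (hT : T ≤ T') (hT' : 0 ≤ T') (hL : L ≤ L') : HorizonLip T' L' F := by
  intro f g r h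
  have hr : 0 ≤ r := (abs_nonneg _).trans (h 0 (by simpa using hT'))
  exact (hF f g r fun s hs => h s (hs.trans hT)).trans (by gcongr)

/-- The algebra of the bounded continuous functionals that are Lipschitz on some horizon. -/
def horizonLipAlgebra : Subalgebra ℝ C(C(ℝ≥0, ℝ), ℝ) where
  carrier := {F | ∃ T L B : ℝ, 0 ≤ T ∧ 0 ≤ L ∧ (∀ f, |F f| ≤ B) ∧ HorizonLip T L F}
  mul_mem' := by
    rintro F G ⟨T, L, B, hT, hL, hB, hF⟩ ⟨T', L', B', hT', hL', hB', hG⟩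
    have B0 : 0 ≤ B := (abs_nonneg _).trans (hB 0)
    have B0' : 0 ≤ B' := (abs_nonneg _).trans (hB' 0)
    refine ⟨max T T', B * L' + B' * L, B * B', le_max_of_le_left hT, by positivity, ?_, ?_⟩
    · intro f
      rw [ContinuousMap.mul_apply, abs_mul]
      exact mul_le_mul (hB f) (hB' f) (abs_nonneg _) B0
    · intro f g r h
      have h1 := (hF.mono (le_max_left T T') (le_max_of_le_left hT) le_rfl) f g r h
      have h2 := (hG.mono (le_max_right T T') (le_max_of_le_left hT) le_rfl) f g r h
      have h3 : (F * G) f - (F * G) g = F f * (G f - G g) + G g * (F f - F g) := by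
        simp only [ContinuousMap.mul_apply]; ring
      calc |(F * G) f - (F * G) g| ≤ |F f| * |G f - G g| + |G g| * |F f - F g| := by
            rw [h3, ← abs_mul, ← abs_mul]; exact abs_add_le _ _
        _ ≤ B * (L' * r) + B' * (L * r) :=
            add_le_add (mul_le_mul (hB f) h2 (abs_nonneg _) B0)
              (mul_le_mul (hB' g) h1 (abs_nonneg _) B0')
        _ = (B * L' + B' * L) * r := by ring
  add_mem' := by
    rintro F G ⟨T, L, B, hT, hL, hB, hF⟩ ⟨T', L', B', hT', hL', hB', hG⟩
    refine ⟨max T T', L + L', B + B', le_max_of_le_left hT, by positivity, ?_, ?_⟩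
    · intro f
      exact (abs_add_le _ _).trans (add_le_add (hB f) (hB' f))
    · intro f g r h
      have h1 := (hF.mono (le_max_left T T') (le_max_of_le_left hT) le_rfl) f g r h
      have h2 := (hG.mono (le_max_right T T') (le_max_of_le_left hT) le_rfl) f g r h
      have h3 : (F + G) f - (F + G) g = (F f - F g) + (G f - G g) := by
        simp only [ContinuousMap.add_apply]; ring
      rw [h3, add_mul]
      exact (abs_add_le _ _).trans (add_le_add h1 h2)
  algebraMap_mem' := by
    intro c
    refine ⟨0, 0, |c|, le_rfl, le_rfl, fun f => by simp, fun f g r _ => by simp⟩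

/-- Evaluation at a time where the paths differ separates them. Truncating it at a level above both
values makes it bounded without changing it at these two paths. -/
theorem horizonLipAlgebra_separatesPoints : horizonLipAlgebra.SeparatesPoints := by
  intro f g hfg
  obtain ⟨s, hs⟩ : ∃ s, f s ≠ g s := by
    by_contra! h
    exact hfg (ContinuousMap.ext h)
  set M := |f s| + |g s| with hM
  have hc : Continuous fun k : C(ℝ≥0, ℝ) => max (-M) (min M (k s)) := by
    have := continuous_eval_const (F := C(ℝ≥0, ℝ)) s
    fun_prop
  have hM0 : 0 ≤ M := by positivity
  refine ⟨_, ⟨⟨_, hc⟩, ⟨s, 1, M, s.2, zero_le_one, fun k => ?_, fun k k' r h => ?_⟩, rfl⟩, ?_⟩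
  · exact abs_le.2 ⟨le_max_left _ _, max_le (by linarith) (min_le_left _ _)⟩
  · rw [one_mul]
    refine le_trans ?_ (h s le_rfl)
    refine (abs_max_sub_max_le_max _ _ _ _).trans ?_
    rw [sub_self, abs_zero, max_eq_right (abs_nonneg _)]
    refine (abs_min_sub_min_le_max _ _ _ _).trans ?_
    rw [sub_self, abs_zero, max_eq_right (abs_nonneg _)]
  · have h1 := abs_le.1 (show |f s| ≤ M by rw [hM]; linarith [abs_nonneg (g s)])
    have h2 := abs_le.1 (show |g s| ≤ M by rw [hM]; linarith [abs_nonneg (f s)])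
    simpa [min_eq_right h1.2, min_eq_right h2.2, max_eq_right h1.1, max_eq_right h2.1] using hs

theorem abs_integral_path_sub_le {α : Type*} [MeasurableSpace α] {Q : Measure α}
    [IsProbabilityMeasure Q] {W : α → C(ℝ≥0, ℝ)} (hW : AEMeasurable W Q) {K : Set C(ℝ≥0, ℝ)}
    (hK : ∀ᵐ ω ∂Q, W ω ∈ K) {F G : C(C(ℝ≥0, ℝ), ℝ)} {B B' η : ℝ} (hF : ∀ f, |F f| ≤ B)
    (hG : ∀ f, |G f| ≤ B') (hFG : ∀ f ∈ K, ‖F f - G f‖ < η) :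
    |∫ ω, F (W ω) ∂Q - ∫ ω, G (W ω) ∂Q| ≤ η := by
  have h1 : Integrable (fun ω => F (W ω)) Q :=
    Integrable.of_bound (F.continuous.measurable.comp_aemeasurable hW).aestronglyMeasurable B
      (ae_of_all _ fun ω => hF _)
  have h2 : Integrable (fun ω => G (W ω)) Q :=
    Integrable.of_bound (G.continuous.measurable.comp_aemeasurable hW).aestronglyMeasurable B'
      (ae_of_all _ fun ω => hG _)
  rw [← integral_sub h1 h2]
  have h3 : ∀ᵐ ω ∂Q, ‖F (W ω) - G (W ω)‖ ≤ η := by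
    filter_upwards [hK] with ω hω using (hFG _ hω).le
  simpa using norm_integral_le_of_norm_le_const h3

/-- Random paths in a compact set of Lipschitz paths converge in distribution as soon as the
expectations of the functionals that are `1`-Lipschitz on some horizon converge. -/
theorem tendstoInDistribution_of_horizonLip {ι : Type*} {Ω : ι → Type*}
    [∀ i, MeasurableSpace (Ω i)] {Ω' : Type*} [MeasurableSpace Ω'] {P : ∀ i, Measure (Ω i)}
    [∀ i, IsProbabilityMeasure (P i)] {P' : Measure Ω'} [IsProbabilityMeasure P'] {l : Filter ι}
    {X : ∀ i, Ω i → C(ℝ≥0, ℝ)} {Z : Ω' → C(ℝ≥0, ℝ)} (hX : ∀ i, AEMeasurable (X i) (P i))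
    (hZ : AEMeasurable Z P') (r : ℝ) (hXr : ∀ᶠ i in l, ∀ᵐ ω ∂(P i), X i ω ∈ lipPaths r)
    (hZr : ∀ᵐ ω ∂P', Z ω ∈ lipPaths r)
    (h : ∀ (F : C(C(ℝ≥0, ℝ), ℝ)) (T : ℝ), 0 ≤ T → HorizonLip T 1 F →
      Tendsto (fun i => ∫ ω, F (X i ω) ∂(P i)) l (𝓝 (∫ ω, F (Z ω) ∂P'))) :
    TendstoInDistribution X l Z P P' := by
  refine ⟨hX, hZ, ?_⟩
  refine ProbabilityMeasure.tendsto_iff_forall_integral_tendsto.2 fun G => ?_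
  have hmap : ∀ i, ∫ f, G f ∂((P i).map (X i)) = ∫ ω, G (X i ω) ∂(P i) := fun i =>
    integral_map (hX i) G.continuous.measurable.aestronglyMeasurable
  have hmap' : ∫ f, G f ∂(P'.map Z) = ∫ ω, G (Z ω) ∂P' :=
    integral_map hZ G.continuous.measurable.aestronglyMeasurable
  simp only [ProbabilityMeasure.coe_mk, hmap, hmap']
  rw [Metric.tendsto_nhds]
  intro η hη
  -- Stone-Weierstrass on the compact set of paths. Replacing `G` by `F` costs `η / 4` on each side,
  -- and the convergence for `F` another `η / 4`.
  obtain ⟨F, ⟨T, L, B, hT, hL, hB, hF⟩, hFG⟩ :=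
    ContinuousMap.exists_mem_subalgebra_near_continuous_of_isCompact_of_separatesPoints
      horizonLipAlgebra_separatesPoints G.toContinuousMap (isCompact_lipPaths r)
      (show 0 < η / 4 by positivity)
  -- Rescaling by `L + 1` rather than `L` covers the case `L = 0`.
  have hL1 : 0 < L + 1 := by positivity
  have hlim : Tendsto (fun i => ∫ ω, F (X i ω) ∂(P i)) l (𝓝 (∫ ω, F (Z ω) ∂P')) := by
    have := (h ((L + 1)⁻¹ • F) T hT ?_).const_mul (L + 1)
    · simpa [integral_const_mul, mul_inv_cancel_left₀ hL1.ne'] using this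
    · intro f g r hr
      have h0 : 0 ≤ r := (abs_nonneg _).trans (hr 0 (by simpa using hT))
      have := hF f g r hr
      simp only [ContinuousMap.smul_apply, smul_eq_mul, ← mul_sub, abs_mul, abs_inv,
        abs_of_pos hL1, one_mul]
      rw [inv_mul_le_iff₀ hL1]
      nlinarith
  filter_upwards [hXr, Metric.tendsto_nhds.1 hlim (η / 4) (by positivity)] with i hi hi'
  have h1 := abs_integral_path_sub_le (hX i) hi hB G.norm_coe_le_norm hFG
  have h2 := abs_integral_path_sub_le hZ hZr hB G.norm_coe_le_norm hFG
  simp only [BoundedContinuousFunction.coe_toContinuousMap] at h1 h2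
  rw [Real.dist_eq] at hi' ⊢
  rw [abs_lt] at hi' ⊢
  rw [abs_le] at h1 h2
  constructor <;> linarith [h1.1, h1.2, h2.1, h2.2, hi'.1, hi'.2]

/-- A random path is measurable as soon as its values are. -/
theorem measurable_path {α : Type*} [MeasurableSpace α] {φ : α → C(ℝ≥0, ℝ)}
    (h : ∀ s, Measurable fun x => φ x s) : Measurable φ := by
  rw [show pathMeasurableSpace = _ from borel_eq_generateFrom_of_subbasis rfl]
  refine measurable_generateFrom ?_
  rintro _ ⟨K, hK, U, hU, rfl⟩
  obtain ⟨D, hDK, hDc, hD⟩ := hK.isSeparable.exists_countable_dense_subset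
  -- On the compact `K` the distance from `f` to the complement of `U` attains its minimum, so `f`
  -- maps `K` into `U` iff this distance is bounded below. By continuity the bound need only be
  -- tested on a countable dense subset, hence on countably many values of the path.
  have key : ∀ f : C(ℝ≥0, ℝ), Set.MapsTo f K U ↔
      ∃ n : ℕ, ∀ d ∈ D, (n : ENNReal)⁻¹ ≤ Metric.infEDist (f d) Uᶜ := by
    intro f
    have hcont : Continuous fun s => Metric.infEDist (f s) Uᶜ :=
      Metric.continuous_infEDist.comp f.continuous
    constructor
    · intro hf
      rcases K.eq_empty_or_nonempty with rfl | hne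
      · exact ⟨0, fun d hd => absurd (hDK hd) (Set.notMem_empty d)⟩
      obtain ⟨s, hs, hmin⟩ := hK.exists_isMinOn hne hcont.continuousOn
      have hpos : Metric.infEDist (f s) Uᶜ ≠ 0 := by
        intro h0
        rw [← Metric.mem_closure_iff_infEDist_zero, IsClosed.closure_eq
          (show IsOpen U from hU).isClosed_compl] at h0
        exact h0 (hf hs)
      obtain ⟨n, hn⟩ := ENNReal.exists_inv_nat_lt hpos
      exact ⟨n, fun d hd => hn.le.trans (hmin (hDK hd))⟩
    · rintro ⟨n, hn⟩ s hs
      have hs' : (n : ENNReal)⁻¹ ≤ Metric.infEDist (f s) Uᶜ :=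
        closure_minimal (t := {s | (n : ENNReal)⁻¹ ≤ Metric.infEDist (f s) Uᶜ}) hn
          (isClosed_le continuous_const hcont) (hD hs)
      by_contra hsU
      rw [Metric.infEDist_zero_of_mem (show f s ∈ Uᶜ from hsU)] at hs'
      simp at hs'
  have hpre : φ ⁻¹' {f | Set.MapsTo f K U} =
      ⋃ n : ℕ, ⋂ d ∈ D, {x | (n : ENNReal)⁻¹ ≤ Metric.infEDist (φ x d) Uᶜ} := by
    ext x
    simp [key]
  rw [hpre]
  refine MeasurableSet.iUnion fun n => MeasurableSet.biInter hDc fun d _ => ?_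
  exact measurableSet_le measurable_const (Metric.continuous_infEDist.measurable.comp (h d))

/-! ### Concatenation of paths and the renewal property of the telegraph noise -/

/-- The path that has slope `v` up to time `t` and then continues with the increments of `f`. -/
noncomputable def glue (t : ℝ≥0) (v : ℝ) (f : C(ℝ≥0, ℝ)) : C(ℝ≥0, ℝ) where
  toFun s := v * (min s t : ℝ≥0) + f (s - t)
  continuous_toFun := by fun_prop

theorem glue_apply (t : ℝ≥0) (v : ℝ) (f : C(ℝ≥0, ℝ)) (s : ℝ≥0) :
    glue t v f s = v * (min s t : ℝ≥0) + f (s - t) := rfl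

theorem continuous_glue (t : ℝ≥0) (v : ℝ) : Continuous (glue t v) := by
  let k : C(ℝ≥0, ℝ≥0) := ⟨fun s => s - t, by fun_prop⟩
  let m : C(ℝ≥0, ℝ) := ⟨fun s => v * (min s t : ℝ≥0), by fun_prop⟩
  have h : glue t v = fun f : C(ℝ≥0, ℝ) => m + f.comp k := rfl
  rw [h]
  exact continuous_const.add (ContinuousMap.continuous_precomp k)

theorem glue_add (s t : ℝ≥0) (v : ℝ) (f : C(ℝ≥0, ℝ)) :
    glue (s + t) v f = glue s v (glue t v f) := by
  ext u
  have h : ((min u (s + t) : ℝ≥0) : ℝ) = (min u s : ℝ≥0) + (min (u - s) t : ℝ≥0) := by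
    norm_cast
    rcases le_total u s with hu | hu
    · rw [min_eq_left hu, tsub_eq_zero_of_le hu, min_eq_left (hu.trans le_self_add)]
      simp
    · obtain ⟨w, rfl⟩ := exists_add_of_le hu
      rw [min_add_add_left, add_tsub_cancel_left, min_eq_right le_self_add]
  simp only [glue_apply, h, tsub_tsub]
  ring

theorem coe_min_add_coe_sub (s t : ℝ≥0) : ((min s t : ℝ≥0) : ℝ) + (s - t : ℝ≥0) = s := by
  norm_cast
  rw [add_comm, tsub_add_min]

/-- Moving the gluing time changes the length of the initial piece and delays the continuation. Each
effect costs at most `|t - t'|`, hence the factor 2. -/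
theorem abs_glue_sub_glue_le {f : C(ℝ≥0, ℝ)} {r : ℝ} (hf : f ∈ lipPaths r) {v : ℝ} (hv : |v| = 1)
    (t t' s : ℝ≥0) : |glue t v f s - glue t' v f s| ≤ 2 * |(t : ℝ) - t'| := by
  have h1 : |((min s t : ℝ≥0) : ℝ) - (min s t' : ℝ≥0)| ≤ |(t : ℝ) - t'| := by
    push_cast
    simpa using abs_min_sub_min_le_max (s : ℝ) t s t'
  have h2 := hf.2 (s - t) (s - t')
  have h3 : |((s - t : ℝ≥0) : ℝ) - (s - t' : ℝ≥0)| ≤ |(t : ℝ) - t'| := by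
    rw [show ((s - t : ℝ≥0) : ℝ) - (s - t' : ℝ≥0) =
      -(((min s t : ℝ≥0) : ℝ) - (min s t' : ℝ≥0)) by
        linarith [coe_min_add_coe_sub s t, coe_min_add_coe_sub s t'], abs_neg]
    exact h1
  calc |glue t v f s - glue t' v f s|
      = |v * (((min s t : ℝ≥0) : ℝ) - (min s t' : ℝ≥0)) + (f (s - t) - f (s - t'))| := by
        rw [glue_apply, glue_apply]; congr 1; ring
    _ ≤ |v| * |((min s t : ℝ≥0) : ℝ) - (min s t' : ℝ≥0)| + |f (s - t) - f (s - t')| := by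
        rw [← abs_mul]; exact abs_add_le _ _
    _ ≤ 2 * |(t : ℝ) - t'| := by rw [hv]; linarith

theorem glue_zero (v : ℝ) (f : C(ℝ≥0, ℝ)) : glue 0 v f = f := by
  ext s
  simp [glue_apply]

/-- Once the first `t` units of time are fixed, only the part of `f` up to `T` remains visible on
`[0, T + t]`. The induction on the number of steps consumes the horizon in this way. -/
theorem HorizonLip.comp_glue {T : ℝ} {F : C(ℝ≥0, ℝ) → ℝ} (t : ℝ≥0) (v : ℝ)
    (hF : HorizonLip (T + t) 1 F) (hT : 0 ≤ T) : HorizonLip T 1 fun f => F (glue t v f) := by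
  intro f g r h
  refine hF _ _ r fun s hs => ?_
  rw [glue_apply, glue_apply, add_sub_add_left_eq_sub]
  refine h _ ?_
  rcases le_total s t with hst | hst
  · simpa [tsub_eq_zero_of_le hst] using hT
  · rw [NNReal.coe_sub hst]
    linarith

theorem HorizonLip.abs_sub_glue_le {T : ℝ} {F : C(ℝ≥0, ℝ) → ℝ} (hF : HorizonLip T 1 F)
    {f : C(ℝ≥0, ℝ)} {r : ℝ} (hf : f ∈ lipPaths r) {v : ℝ} (hv : |v| = 1) (t t' : ℝ≥0) :
    |F (glue t v f) - F (glue t' v f)| ≤ 2 * |(t : ℝ) - t'| := by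
  simpa using hF _ _ _ fun s _ => abs_glue_sub_glue_le hf hv t t' s

theorem telegraph_apply (a b : ℝ) (e : ℕ → ℝ) (t : ℝ≥0) :
    telegraph a b e t = ∫ u in (0 : ℝ)..t, (-1 : ℝ) ^ countingProcess a b e u := rfl

theorem measurable_neg_one_pow_countingProcess (a b : ℝ) :
    Measurable fun p : (ℕ → ℝ) × ℝ => (-1 : ℝ) ^ countingProcess a b p.1 p.2 := by
  refine (Measurable.of_discrete (f := fun n : ℕ => (-1 : ℝ) ^ n)).comp ?_
  refine measurable_ncard.comp (measurable_set_iff.2 fun k => ?_)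
  refine Measurable.and measurable_const ?_
  refine measurableSet_setOfPred.1 (measurableSet_le ?_ measurable_snd)
  unfold jumpTime
  fun_prop

theorem intervalIntegrable_neg_one_pow_countingProcess (a b : ℝ) (e : ℕ → ℝ) (r s : ℝ) :
    IntervalIntegrable (fun u : ℝ => (-1 : ℝ) ^ countingProcess a b e u) volume r s :=
  (intervalIntegrable_const (c := (1 : ℝ))).mono_fun
    ((measurable_neg_one_pow_countingProcess a b).comp measurable_prodMk_left).aestronglyMeasurable
    (Eventually.of_forall fun u => by simp)

theorem telegraph_mem_lipPaths (a b : ℝ) (e : ℕ → ℝ) : telegraph a b e ∈ lipPaths 0 := by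
  refine ⟨by simp [telegraph_apply], fun s t => ?_⟩
  rw [telegraph_apply, telegraph_apply, intervalIntegral.integral_interval_sub_left
    (intervalIntegrable_neg_one_pow_countingProcess _ _ _ _ _)
    (intervalIntegrable_neg_one_pow_countingProcess _ _ _ _ _)]
  simpa using intervalIntegral.norm_integral_le_of_norm_le_const (C := 1) (a := (t : ℝ)) (b := s)
    (f := fun u => (-1 : ℝ) ^ countingProcess a b e u) fun u _ => by simp

theorem smul_mem_lipPaths {f : C(ℝ≥0, ℝ)} (hf : f ∈ lipPaths 0) {v : ℝ} (hv : |v| = 1) :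
    v • f ∈ lipPaths 0 := by
  refine ⟨?_, fun s t => ?_⟩
  · simpa [abs_mul, hv] using hf.1
  · simpa [← mul_sub, abs_mul, hv] using hf.2 s t

theorem measurable_telegraph (a b : ℝ) : Measurable (telegraph a b) := by
  refine measurable_path fun s => ?_
  simp only [telegraph_apply]
  have : ∀ e, ∫ u in (0 : ℝ)..s, (-1 : ℝ) ^ countingProcess a b e u =
      ∫ u in Set.Ioc (0 : ℝ) s, (-1 : ℝ) ^ countingProcess a b e u := fun e =>
    intervalIntegral.integral_of_le s.2
  simp only [this]
  exact ((measurable_neg_one_pow_countingProcess a b).stronglyMeasurable.integral_prod_right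
    (ν := volume.restrict (Set.Ioc (0 : ℝ) s))).measurable

theorem jumpTime_succ (a b : ℝ) (e : ℕ → ℝ) (n : ℕ) :
    jumpTime a b e (n + 1) = e 0 / a + jumpTime b a (fun k => e (k + 1)) n := by
  rw [jumpTime, Finset.sum_range_succ', jumpTime, add_comm]
  congr 1
  · simp [div_eq_inv_mul]
  · refine Finset.sum_congr rfl fun k _ => ?_
    by_cases hk : Even k <;> simp [hk, Nat.even_add_one]

theorem jumpTime_nonneg {a b : ℝ} (ha : 0 < a) (hb : 0 < b) {e : ℕ → ℝ} (he : ∀ k, 0 ≤ e k)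
    (n : ℕ) : 0 ≤ jumpTime a b e n := by
  refine Finset.sum_nonneg fun k _ => mul_nonneg ?_ (he k)
  split_ifs <;> positivity

theorem countingProcess_of_lt {a b : ℝ} (ha : 0 < a) (hb : 0 < b) {e : ℕ → ℝ} (he : ∀ k, 0 ≤ e k)
    {u : ℝ} (hu : u < e 0 / a) : countingProcess a b e u = 0 := by
  rw [countingProcess]
  convert Set.ncard_empty ℕ
  refine Set.eq_empty_of_forall_notMem ?_
  rintro (_ | k) ⟨hk, hk'⟩
  · omega
  · rw [jumpTime_succ] at hk'
    have := jumpTime_nonneg hb ha (fun k => he (k + 1)) k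
    linarith

/-- After the first jump the count restarts with the parities, hence the rates, exchanged.
Divergence of the jump times matters: `Set.ncard` of an infinite set is 0, so an explosion would
break the identity. -/
theorem countingProcess_of_le {a b : ℝ} {e : ℕ → ℝ}
    (hlim : Tendsto (jumpTime b a fun k => e (k + 1)) atTop atTop) {u : ℝ} (hu : e 0 / a ≤ u) :
    countingProcess a b e u = countingProcess b a (fun k => e (k + 1)) (u - e 0 / a) + 1 := by
  have hset : {k : ℕ | 1 ≤ k ∧ jumpTime a b e k ≤ u} = Nat.succ ''
      insert 0 {k : ℕ | 1 ≤ k ∧ jumpTime b a (fun k => e (k + 1)) k ≤ u - e 0 / a} := by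
    ext k
    rcases k with _ | k
    · simp
    · rcases k with _ | k
      · have : jumpTime a b e 1 = e 0 / a := by rw [jumpTime_succ]; simp [jumpTime]
        simp [this, hu]
      · simp [jumpTime_succ _ _ _ (k + 1), le_sub_iff_add_le']
  have hfin : {k : ℕ | 1 ≤ k ∧ jumpTime b a (fun k => e (k + 1)) k ≤ u - e 0 / a}.Finite := by
    obtain ⟨n, hn⟩ := eventually_atTop.1 (hlim.eventually_gt_atTop (u - e 0 / a))
    refine (Set.finite_lt_nat n).subset fun k hk => ?_
    by_contra hkn
    exact absurd hk.2 (not_le.2 (hn k (not_lt.1 hkn)))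
  rw [countingProcess, hset, Set.ncard_image_of_injective _ Nat.succ_injective,
    Set.ncard_insert_of_notMem (by simp) hfin, countingProcess]

/-- The renewal property of the telegraph noise at its first jump. -/
theorem telegraph_eq_glue {a b : ℝ} (ha : 0 < a) (hb : 0 < b) {e : ℕ → ℝ} (he : ∀ k, 0 ≤ e k)
    (hlim : Tendsto (jumpTime b a fun k => e (k + 1)) atTop atTop) :
    telegraph a b e = glue (e 0 / a).toNNReal 1 (-telegraph b a fun k => e (k + 1)) := by
  have hτ : 0 ≤ e 0 / a := div_nonneg (he 0) ha.le
  have hbefore : ∀ r : ℝ, 0 ≤ r → r ≤ e 0 / a →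
      ∫ u in (0 : ℝ)..r, (-1 : ℝ) ^ countingProcess a b e u = r := by
    intro r hr hr'
    -- The open interval is needed because the count is already 1 at the time `e 0 / a`.
    rw [intervalIntegral.integral_congr_Ioo_of_le (g := fun _ => (1 : ℝ)) hr]
    · simp
    · intro u hu
      simp [countingProcess_of_lt ha hb he (hu.2.trans_le hr')]
  ext s
  rw [telegraph_apply, glue_apply]
  rcases le_total (s : ℝ) (e 0 / a) with hs | hs
  · have hs' : s ≤ (e 0 / a).toNNReal := NNReal.le_toNNReal_of_coe_le hs
    rw [hbefore s s.2 hs, min_eq_left hs', tsub_eq_zero_of_le hs']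
    simp [telegraph_apply]
  · have hs' : (e 0 / a).toNNReal ≤ s := Real.toNNReal_le_iff_le_coe.2 hs
    rw [min_eq_right hs', ContinuousMap.neg_apply, telegraph_apply, NNReal.coe_sub hs',
      Real.coe_toNNReal _ hτ, ← intervalIntegral.integral_add_adjacent_intervals
      (intervalIntegrable_neg_one_pow_countingProcess _ _ _ _ (e 0 / a))
      (intervalIntegrable_neg_one_pow_countingProcess _ _ _ _ _), hbefore _ hτ le_rfl, one_mul]
    congr 1
    rw [← sub_self (e 0 / a), ← intervalIntegral.integral_comp_sub_right,
      ← intervalIntegral.integral_neg]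
    refine intervalIntegral.integral_congr fun u hu => ?_
    rw [Set.uIcc_of_le hs] at hu
    simp only [countingProcess_of_le hlim hu.1, pow_succ]
    ring

/-! ### The exponential distribution and sequences of exponential variables -/

instance isProbabilityMeasure_expMeasure_one : IsProbabilityMeasure (expMeasure 1) :=
  isProbabilityMeasure_expMeasure one_pos

theorem expMeasure_one_eq : expMeasure 1 = (volume.restrict (Set.Ici (0 : ℝ))).withDensity
    fun x => ENNReal.ofReal (Real.exp (-x)) := by
  rw [← withDensity_indicator measurableSet_Ici, expMeasure, gammaMeasure]
  congr 1
  ext x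
  have := exponentialPDF_eq 1 x
  rw [exponentialPDF, exponentialPDFReal] at this
  rw [gammaPDF, this, Set.indicator_apply]
  by_cases hx : 0 ≤ x <;> simp [hx]

theorem integral_expMeasure_one (g : ℝ → ℝ) :
    ∫ t, g t ∂(expMeasure 1) = ∫ t in Set.Ioi 0, Real.exp (-t) * g t := by
  rw [expMeasure_one_eq, integral_withDensity_eq_integral_toReal_smul (by fun_prop)
    (ae_of_all _ fun _ => ENNReal.ofReal_lt_top), integral_Ici_eq_integral_Ioi]
  simp [Real.exp_nonneg]

theorem integrable_expMeasure_one_iff (g : ℝ → ℝ) :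
    Integrable g (expMeasure 1) ↔ IntegrableOn (fun t => Real.exp (-t) * g t) (Set.Ioi 0) := by
  rw [expMeasure_one_eq, integrable_withDensity_iff_integrable_smul' (by fun_prop)
    (ae_of_all _ fun _ => ENNReal.ofReal_lt_top), ← IntegrableOn, integrableOn_Ici_iff_integrableOn_Ioi]
  simp [Real.exp_nonneg]

theorem ae_nonneg_expMeasure_one : ∀ᵐ t ∂(expMeasure 1), 0 ≤ t := by
  rw [expMeasure_one_eq]
  exact (withDensity_absolutelyContinuous _ _).ae_le (ae_restrict_mem measurableSet_Ici)

theorem integrable_id_expMeasure_one : Integrable (fun t : ℝ => t) (expMeasure 1) := by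
  rw [integrable_expMeasure_one_iff]
  refine (Real.GammaIntegral_convergent (s := 2) two_pos).congr_fun (fun t _ => ?_)
    measurableSet_Ioi
  norm_num

theorem integral_id_expMeasure_one : ∫ t, t ∂(expMeasure 1) = 1 := by
  rw [integral_expMeasure_one, ← Real.Gamma_two, Real.Gamma_eq_integral two_pos]
  refine setIntegral_congr_fun measurableSet_Ioi fun t _ => ?_
  norm_num

/-- One step of length `δ` of the renewal equation at rate `a`, up to an error of order `δ ^ 2`. -/
theorem abs_integral_expMeasure_sub_le {a δ : ℝ} (ha : 0 < a) (hδ : 0 ≤ δ) (haδ : a * δ ≤ 1)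
    {g : ℝ → ℝ} (hg : ∀ s t, |g s - g t| ≤ 2 * |s - t|) :
    |∫ t, g (t / a) ∂(expMeasure 1) -
      ((1 - a * δ) * ∫ t, g (t / a + δ) ∂(expMeasure 1) + a * δ * g δ)| ≤ 4 * a * δ ^ 2 := by
  have haδ0 : 0 ≤ a * δ := by positivity
  have hcont : Continuous g := by
    refine LipschitzWith.continuous (K := 2) (LipschitzWith.of_dist_le_mul fun s t => ?_)
    simpa [Real.dist_eq] using hg s t
  -- Subtracting the constant `g δ` removes the jump term and leaves a function vanishing at `δ`, so
  -- that `G` is of order `δ` on `[0, δ]`.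
  set G : ℝ → ℝ := fun t => g t - g δ with hG
  have hGcont : Continuous G := by fun_prop
  have hGint : ∀ c : ℝ, Integrable (fun t => G (t / a + c)) (expMeasure 1) := by
    intro c
    refine Integrable.mono' (g := fun t => 2 * (|t| / a + |c - δ|)) ?_
      (by fun_prop) (ae_of_all _ fun t => ?_)
    · exact ((integrable_id_expMeasure_one.abs.div_const a).add (integrable_const _)).const_mul 2
    · refine (hg _ _).trans ?_
      have : |t / a + c - δ| ≤ |t| / a + |c - δ| := by
        rw [add_sub_assoc, ← abs_of_pos ha, ← abs_div, abs_of_pos ha]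
        exact abs_add_le _ _
      linarith
  have hmean : ∀ c : ℝ, ∫ t, g (t / a + c) ∂(expMeasure 1) =
      g δ + ∫ t, G (t / a + c) ∂(expMeasure 1) := by
    intro c
    have h1 := integral_add (integrable_const (μ := expMeasure 1) (g δ)) (hGint c)
    simp only [integral_const, probReal_univ, one_smul] at h1
    rw [← h1]
    simp [hG]
  set J := ∫ t, G (t / a + δ) ∂(expMeasure 1) with hJ
  have hJle : |J| ≤ 2 / a := by
    have h1 : ∀ᵐ t ∂(expMeasure 1), ‖G (t / a + δ)‖ ≤ 2 / a * t := by
      filter_upwards [ae_nonneg_expMeasure_one] with t ht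
      refine (hg _ _).trans (le_of_eq ?_)
      rw [add_sub_cancel_right, abs_of_nonneg (by positivity)]
      ring
    refine (norm_integral_le_of_norm_le (integrable_id_expMeasure_one.const_mul (2 / a)) h1).trans ?_
    rw [integral_const_mul, integral_id_expMeasure_one, mul_one]
  set I := ∫ t in (0 : ℝ)..(a * δ), Real.exp (-t) * G (t / a) with hI
  have hIle : |I| ≤ 2 * a * δ ^ 2 := by
    have h1 := intervalIntegral.norm_integral_le_of_norm_le_const (C := 2 * δ) (a := 0)
      (b := a * δ) (f := fun t => Real.exp (-t) * G (t / a)) fun t ht => ?_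
    · rw [sub_zero, abs_of_nonneg haδ0] at h1
      exact h1.trans (le_of_eq (by ring))
    · rw [Set.uIoc_of_le haδ0] at ht
      have h2 : |G (t / a)| ≤ 2 * δ := by
        refine (hg _ _).trans ?_
        have h3 : 0 ≤ t / a := div_nonneg ht.1.le ha.le
        have h4 : t / a ≤ δ := by rw [div_le_iff₀ ha]; linarith [ht.2]
        rw [abs_sub_comm, abs_of_nonneg (by linarith)]
        linarith
      rw [norm_mul, Real.norm_eq_abs, Real.norm_eq_abs, abs_of_pos (Real.exp_pos _)]
      have h5 : Real.exp (-t) ≤ 1 := Real.exp_le_one_iff.2 (by linarith [ht.1])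
      calc Real.exp (-t) * |G (t / a)| ≤ 1 * (2 * δ) :=
            mul_le_mul h5 h2 (abs_nonneg _) zero_le_one
        _ = 2 * δ := one_mul _
  -- Memorylessness: beyond `a * δ` the exponential law is a translate of itself with mass `exp (-(a
  -- * δ))`. Replacing this mass by `1 - a * δ` costs `(a * δ) ^ 2 * (2 / a)`, which with the bound
  -- on `I` gives `4 * a * δ ^ 2`.
  have hsplit : ∫ t, G (t / a) ∂(expMeasure 1) = I + Real.exp (-(a * δ)) * J := by
    have hint : IntegrableOn (fun t => Real.exp (-t) * G (t / a)) (Set.Ioi 0) := by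
      rw [← integrable_expMeasure_one_iff]
      simpa using hGint 0
    rw [integral_expMeasure_one, ← intervalIntegral.integral_interval_add_Ioi hint
      (hint.mono_set (Set.Ioi_subset_Ioi haδ0)), ← hI, hJ, integral_expMeasure_one,
      ← integral_const_mul]
    congr 1
    have := (measurePreserving_add_right volume (a * δ)).setIntegral_preimage_emb
      (measurableEmbedding_addRight (a * δ)) (fun t => Real.exp (-t) * G (t / a))
      (Set.Ioi (a * δ))
    rw [Set.preimage_add_const_Ioi, sub_self] at this
    rw [← this]
    refine setIntegral_congr_fun measurableSet_Ioi fun t _ => ?_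
    rw [neg_add, Real.exp_add, add_div, mul_div_cancel_left₀ _ ha.ne']
    ring
  have h0 : ∫ t, g (t / a) ∂(expMeasure 1) = g δ + ∫ t, G (t / a) ∂(expMeasure 1) := by
    simpa using hmean 0
  rw [h0, hmean δ, hsplit]
  have hexp := Real.abs_exp_sub_one_sub_id_le (x := -(a * δ)) (by rwa [abs_neg, abs_of_nonneg haδ0])
  calc |g δ + (I + Real.exp (-(a * δ)) * J) - ((1 - a * δ) * (g δ + J) + a * δ * g δ)|
      = |I + (Real.exp (-(a * δ)) - 1 - -(a * δ)) * J| := by congr 1; ring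
    _ ≤ |I| + |Real.exp (-(a * δ)) - 1 - -(a * δ)| * |J| := by
        rw [← abs_mul]; exact abs_add_le _ _
    _ ≤ 2 * a * δ ^ 2 + (-(a * δ)) ^ 2 * (2 / a) :=
        add_le_add hIle (mul_le_mul hexp hJle (abs_nonneg _) (by positivity))
    _ = 4 * a * δ ^ 2 := by field_simp; ring

/-- The law of a sequence of independent exponential variables of mean one. -/
noncomputable def expSeqMeasure : Measure (ℕ → ℝ) := Measure.infinitePi fun _ => expMeasure 1

instance isProbabilityMeasure_expSeqMeasure : IsProbabilityMeasure expSeqMeasure := by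
  unfold expSeqMeasure
  infer_instance

/-- Prepending a term to a sequence. -/
def consSeq (p : ℝ × (ℕ → ℝ)) (k : ℕ) : ℝ := Nat.casesOn k p.1 p.2

theorem measurable_consSeq : Measurable consSeq := by
  refine measurable_pi_iff.2 fun k => ?_
  cases k
  · exact measurable_fst
  · exact (measurable_pi_apply _).comp measurable_snd

/-- A product measure is determined by finite boxes. Padding a box with `Set.univ` to an initial
segment of indices lets its first coordinate be split off. -/
theorem measurePreserving_consSeq :
    MeasurePreserving consSeq ((expMeasure 1).prod expSeqMeasure) expSeqMeasure := by
  refine ⟨measurable_consSeq, Measure.eq_infinitePi _ fun s t ht => ?_⟩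
  classical
  obtain ⟨n, hn⟩ : ∃ n, s ⊆ Finset.range (n + 1) :=
    ⟨s.sup id, fun k hk => Finset.mem_range.2 (Nat.lt_succ_of_le (Finset.le_sup (f := id) hk))⟩
  set t' : ℕ → Set ℝ := fun k => if k ∈ s then t k else Set.univ with ht'
  have htm : ∀ k, MeasurableSet (t' k) := fun k => by
    by_cases hk : k ∈ s <;> simp [ht', hk, ht]
  have hpi : Set.pi s t = Set.pi (Finset.range (n + 1)) t' := by
    ext x
    simp only [Set.mem_pi, Finset.mem_coe, ht']
    constructor
    · intro h k _
      by_cases hk : k ∈ s <;> simp [hk, h]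
    · intro h k hk
      simpa [hk] using h k (hn hk)
  have hprod : ∏ k ∈ s, expMeasure 1 (t k) = ∏ k ∈ Finset.range (n + 1), expMeasure 1 (t' k) := by
    rw [← Finset.prod_subset hn]
    · exact Finset.prod_congr rfl fun k hk => by simp [ht', hk]
    · intro k _ hk
      simp [ht', hk]
  have hpre : consSeq ⁻¹' Set.pi (Finset.range (n + 1)) t' =
      t' 0 ×ˢ Set.pi (Finset.range n) fun k => t' (k + 1) := by
    ext p
    simp only [Set.mem_preimage, Set.mem_pi, Finset.mem_coe, Finset.mem_range, Set.mem_prod]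
    constructor
    · exact fun h => ⟨h 0 n.succ_pos, fun k hk => h (k + 1) (by omega)⟩
    · rintro ⟨h0, h⟩ (_ | k) hk
      · exact h0
      · exact h k (by omega)
  rw [hpi, hprod, Measure.map_apply measurable_consSeq
    (MeasurableSet.pi (Finset.countable_toSet _) fun k _ => htm k), hpre, Measure.prod_prod,
    expSeqMeasure, Measure.infinitePi_pi _ (fun k _ => htm (k + 1)), Finset.prod_range_succ',
    mul_comm]

theorem ae_nonneg_expSeqMeasure : ∀ᵐ e ∂expSeqMeasure, ∀ k, 0 ≤ e k := by
  refine ae_all_iff.2 fun k => ?_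
  have := (measurePreserving_eval_infinitePi (fun _ : ℕ => expMeasure 1) k).quasiMeasurePreserving
  exact this.ae ae_nonneg_expMeasure_one

/-- By the strong law the partial sums grow like `n`. This excludes explosion of the jump times. -/
theorem ae_tendsto_sum_expSeqMeasure :
    ∀ᵐ e ∂expSeqMeasure, Tendsto (fun n => ∑ k ∈ Finset.range n, e k) atTop atTop := by
  have hmp := measurePreserving_eval_infinitePi fun _ : ℕ => expMeasure 1
  have hint : Integrable (fun e : ℕ → ℝ => e 0) expSeqMeasure :=
    (hmp 0).integrable_comp_of_integrable integrable_id_expMeasure_one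
  have hmean : ∫ e, e 0 ∂expSeqMeasure = 1 := by
    rw [← integral_id_expMeasure_one, ← (hmp 0).map_eq,
      integral_map (measurable_pi_apply 0).aemeasurable (by fun_prop)]
    rfl
  have hindep : iIndepFun (fun (k : ℕ) (e : ℕ → ℝ) => e k) expSeqMeasure :=
    iIndepFun_infinitePi (P := fun _ : ℕ => expMeasure 1) (X := fun _ x => x) fun _ => measurable_id
  have hslln := strong_law_ae_real (fun (k : ℕ) (e : ℕ → ℝ) => e k) hint
    (fun i j hij => hindep.indepFun hij) fun k =>
      ⟨(measurable_pi_apply k).aemeasurable, (measurable_pi_apply 0).aemeasurable,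
        (hmp k).map_eq.trans (hmp 0).map_eq.symm⟩
  filter_upwards [hslln] with e he
  rw [hmean] at he
  refine (he.pos_mul_atTop one_pos tendsto_natCast_atTop_atTop).congr' ?_
  filter_upwards [eventually_gt_atTop 0] with n hn
  have : (n : ℝ) ≠ 0 := by positivity
  field_simp

theorem ae_tendsto_jumpTime {a b : ℝ} (ha : 0 < a) (hb : 0 < b) :
    ∀ᵐ e ∂expSeqMeasure, Tendsto (jumpTime a b e) atTop atTop := by
  filter_upwards [ae_nonneg_expSeqMeasure, ae_tendsto_sum_expSeqMeasure] with e he hlim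
  have hm : 0 < min (1 / a) (1 / b) := by positivity
  refine tendsto_atTop_mono (fun n => ?_) (hlim.const_mul_atTop hm)
  rw [jumpTime, Finset.mul_sum]
  refine Finset.sum_le_sum fun k _ => mul_le_mul_of_nonneg_right ?_ (he k)
  split_ifs
  exacts [min_le_left _ _, min_le_right _ _]

/-! ### The expectation of a functional of the telegraph noise -/

/-- The expectation of `F` at the integrated telegraph noise with initial velocity `v`. -/
noncomputable def telegraphMean (v a b : ℝ) (F : C(ℝ≥0, ℝ) → ℝ) : ℝ :=
  ∫ e, F (v • telegraph a b e) ∂expSeqMeasure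

/-- Functionals that are Lipschitz on a horizon need not be bounded, but they are bounded on
`lipPaths r`. This provides the integrability of `F` along the random paths below. -/
theorem HorizonLip.abs_le {T : ℝ} {F : C(ℝ≥0, ℝ) → ℝ} (hF : HorizonLip T 1 F) {f : C(ℝ≥0, ℝ)}
    {r : ℝ} (hf : f ∈ lipPaths r) : |F f| ≤ |F 0| + (T + r) := by
  have h := hF f 0 (T + r) fun s hs => ?_
  · have := abs_sub_abs_le_abs_sub (F f) (F 0)
    linarith
  · have h1 := hf.2 s 0
    have h2 := abs_sub_abs_le_abs_sub (f s) (f 0)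
    have h3 := hf.1
    simp only [NNReal.coe_zero, sub_zero, NNReal.abs_eq] at h1
    simp only [ContinuousMap.zero_apply, sub_zero]
    linarith

theorem glue_mem_lipPaths {f : C(ℝ≥0, ℝ)} (hf : f ∈ lipPaths 0) {v : ℝ} (hv : |v| = 1) (t : ℝ≥0) :
    glue t v f ∈ lipPaths 0 := by
  have h0 : f 0 = 0 := abs_nonpos_iff.1 hf.1
  refine ⟨by simp [glue_apply, h0], fun s u => ?_⟩
  have h2 := hf.2 (s - t) (u - t)
  have hs := coe_min_add_coe_sub s t
  have hu := coe_min_add_coe_sub u t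
  -- The times spent before and after the gluing are both monotone in `s` and sum to `s`, so their
  -- increments add up exactly.
  have h1 : |((min s t : ℝ≥0) : ℝ) - (min u t : ℝ≥0)| + |((s - t : ℝ≥0) : ℝ) - (u - t : ℝ≥0)| =
      |(s : ℝ) - u| := by
    rcases le_total s u with hsu | hsu
    · have h3 : ((min s t : ℝ≥0) : ℝ) ≤ (min u t : ℝ≥0) := by gcongr
      have h4 : ((s - t : ℝ≥0) : ℝ) ≤ (u - t : ℝ≥0) := by gcongr
      have h5 : (s : ℝ) ≤ u := hsu
      rw [abs_of_nonpos (by linarith), abs_of_nonpos (by linarith), abs_of_nonpos (by linarith)]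
      linarith
    · have h3 : ((min u t : ℝ≥0) : ℝ) ≤ (min s t : ℝ≥0) := by gcongr
      have h4 : ((u - t : ℝ≥0) : ℝ) ≤ (s - t : ℝ≥0) := by gcongr
      have h5 : (u : ℝ) ≤ s := hsu
      rw [abs_of_nonneg (by linarith), abs_of_nonneg (by linarith), abs_of_nonneg (by linarith)]
      linarith
  calc |glue t v f s - glue t v f u|
      = |v * (((min s t : ℝ≥0) : ℝ) - (min u t : ℝ≥0)) + (f (s - t) - f (u - t))| := by
        rw [glue_apply, glue_apply]; congr 1; ring
    _ ≤ |v| * |((min s t : ℝ≥0) : ℝ) - (min u t : ℝ≥0)| + |f (s - t) - f (u - t)| := by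
        rw [← abs_mul]; exact abs_add_le _ _
    _ ≤ |(s : ℝ) - u| := by rw [hv]; linarith

theorem measurable_glue (v : ℝ) : Measurable fun p : ℝ≥0 × C(ℝ≥0, ℝ) => glue p.1 v p.2 := by
  refine measurable_path fun s => ?_
  have heval : Measurable fun q : C(ℝ≥0, ℝ) × ℝ≥0 => q.1 q.2 := continuous_eval.measurable
  have h1 : Measurable fun p : ℝ≥0 × C(ℝ≥0, ℝ) => p.2 (s - p.1) :=
    heval.comp (measurable_snd.prodMk (measurable_const.sub measurable_fst))
  have h2 : Measurable fun p : ℝ≥0 × C(ℝ≥0, ℝ) => v * (min s p.1 : ℝ≥0) := by fun_prop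
  exact h2.add h1

section

variable {v a b T : ℝ} {F : C(ℝ≥0, ℝ) → ℝ}

theorem smul_telegraph_mem_lipPaths (hv : |v| = 1) (e : ℕ → ℝ) :
    v • telegraph a b e ∈ lipPaths 0 :=
  smul_mem_lipPaths (telegraph_mem_lipPaths a b e) hv

theorem measurable_smul_telegraph (v a b : ℝ) : Measurable fun e => v • telegraph a b e := by
  refine measurable_path fun s => ?_
  simp only [ContinuousMap.smul_apply, smul_eq_mul]
  have := (continuous_eval_const (F := C(ℝ≥0, ℝ)) s).measurable.comp (measurable_telegraph a b)
  exact this.const_mul v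

theorem smul_telegraph_consSeq_ae (ha : 0 < a) (hb : 0 < b) :
    ∀ᵐ p ∂((expMeasure 1).prod expSeqMeasure), v • telegraph a b (consSeq p) =
      glue (p.1 / a).toNNReal v (-v • telegraph b a p.2) := by
  have h1 : ∀ᵐ p ∂((expMeasure 1).prod expSeqMeasure), ∀ k, 0 ≤ consSeq p k :=
    measurePreserving_consSeq.quasiMeasurePreserving.ae ae_nonneg_expSeqMeasure
  have h2 : ∀ᵐ p ∂((expMeasure 1).prod expSeqMeasure), Tendsto (jumpTime b a p.2) atTop atTop :=
    Measure.quasiMeasurePreserving_snd.ae (ae_tendsto_jumpTime hb ha)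
  filter_upwards [h1, h2] with p hp hp'
  have h : telegraph a b (consSeq p) = glue (p.1 / a).toNNReal 1 (-telegraph b a p.2) :=
    telegraph_eq_glue ha hb hp hp'
  rw [h]
  ext s
  simp only [ContinuousMap.smul_apply, glue_apply, ContinuousMap.neg_apply, smul_eq_mul]
  ring

theorem integrable_telegraph_glue (hF : Continuous F) (hFT : HorizonLip T 1 F) (hv : |v| = 1)
    (g : ℝ → ℝ≥0) (hg : Measurable g) : Integrable (fun p : ℝ × (ℕ → ℝ) =>
      F (glue (g p.1) v (-v • telegraph b a p.2))) ((expMeasure 1).prod expSeqMeasure) := by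
  have hm : Measurable fun p : ℝ × (ℕ → ℝ) => F (glue (g p.1) v (-v • telegraph b a p.2)) :=
    hF.measurable.comp ((measurable_glue v).comp ((hg.comp measurable_fst).prodMk
      ((measurable_smul_telegraph _ _ _).comp measurable_snd)))
  exact Integrable.of_bound hm.aestronglyMeasurable _ (ae_of_all _ fun p => hFT.abs_le
    (glue_mem_lipPaths (smul_telegraph_mem_lipPaths (by rwa [abs_neg]) _) hv _))

theorem telegraphMean_eq_integral_glue (hF : Continuous F) (hFT : HorizonLip T 1 F)
    (hv : |v| = 1) (ha : 0 < a) (hb : 0 < b) : telegraphMean v a b F =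
      ∫ t, (∫ e, F (glue (t / a).toNNReal v (-v • telegraph b a e)) ∂expSeqMeasure)
        ∂(expMeasure 1) := by
  have hm : Measurable fun e => F (v • telegraph a b e) :=
    hF.measurable.comp (measurable_smul_telegraph _ _ _)
  have hmap : telegraphMean v a b F =
      ∫ p, F (v • telegraph a b (consSeq p)) ∂((expMeasure 1).prod expSeqMeasure) := by
    rw [telegraphMean, ← integral_map measurable_consSeq.aemeasurable hm.aestronglyMeasurable,
      measurePreserving_consSeq.map_eq]
  rw [← integral_prod _ (integrable_telegraph_glue hF hFT hv (fun t => (t / a).toNNReal)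
    (by fun_prop)), hmap]
  refine integral_congr_ae ?_
  filter_upwards [smul_telegraph_consSeq_ae ha hb] with p hp
  rw [hp]

/-- A discrete form of the generator: within time `δ` the velocity flips with probability `a * δ` up
to second order. Conditioning on the first jump turns the expectation into the integral of a
2-Lipschitz function of the jump time, to which `abs_integral_expMeasure_sub_le` applies. -/
theorem abs_telegraphMean_sub_le (hF : Continuous F) (hT : 0 ≤ T) (hFT : HorizonLip T 1 F)
    (hv : |v| = 1) (ha : 0 < a) (hb : 0 < b) (δ : ℝ≥0) (haδ : a * δ ≤ 1) :
    |telegraphMean v a b F - ((1 - a * δ) * telegraphMean v a b (fun f => F (glue δ v f)) +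
      a * δ * telegraphMean (-v) b a fun f => F (glue δ v f))| ≤ 4 * a * (δ : ℝ) ^ 2 := by
  set g : ℝ → ℝ := fun t => ∫ e, F (glue t.toNNReal v (-v • telegraph b a e)) ∂expSeqMeasure
    with hg
  have hint : ∀ t : ℝ, Integrable (fun e => F (glue t.toNNReal v (-v • telegraph b a e)))
      expSeqMeasure := fun t =>
    Integrable.of_bound (hF.measurable.comp ((continuous_glue _ v).measurable.comp
      (measurable_smul_telegraph _ _ _))).aestronglyMeasurable _ (ae_of_all _ fun e => hFT.abs_le
        (glue_mem_lipPaths (smul_telegraph_mem_lipPaths (by rwa [abs_neg]) _) hv _))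
  have hlip : ∀ s t, |g s - g t| ≤ 2 * |s - t| := by
    intro s t
    rw [hg, ← integral_sub (hint s) (hint t)]
    have hb : ∀ᵐ e ∂expSeqMeasure, ‖F (glue s.toNNReal v (-v • telegraph b a e)) -
        F (glue t.toNNReal v (-v • telegraph b a e))‖ ≤ 2 * |s - t| := by
      refine ae_of_all _ fun e => ?_
      refine (hFT.abs_sub_glue_le
        (smul_telegraph_mem_lipPaths (by rwa [abs_neg]) e) hv _ _).trans ?_
      have : |max s 0 - max t 0| ≤ |s - t| := by simpa using abs_max_sub_max_le_max s 0 t 0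
      simpa using this
    simpa using norm_integral_le_of_norm_le_const hb
  have hFT' : HorizonLip T 1 fun f => F (glue δ v f) :=
    (hFT.mono (le_add_of_nonneg_right δ.2) (add_nonneg hT δ.2) le_rfl).comp_glue δ v hT
  have h1 := telegraphMean_eq_integral_glue hF hFT hv ha hb
  have h2 := telegraphMean_eq_integral_glue (hF.comp (continuous_glue δ v)) hFT' hv ha hb
  have h3 : telegraphMean (-v) b a (fun f => F (glue δ v f)) = g δ := by
    simp [hg, telegraphMean]
  have h4 : telegraphMean v a b (fun f => F (glue δ v f)) = ∫ t, g (t / a + δ) ∂(expMeasure 1) := by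
    refine h2.trans (integral_congr_ae ?_)
    filter_upwards [ae_nonneg_expMeasure_one] with t ht
    simp only [Function.comp_def, hg]
    -- A first jump at `δ + t / a` amounts to a step of length `δ` followed by a fresh first jump at
    -- `t / a`.
    have hadd : (t / a + δ).toNNReal = δ + (t / a).toNNReal := by
      rw [Real.toNNReal_add (by positivity) δ.coe_nonneg, Real.toNNReal_coe, add_comm]
    simp only [hadd, glue_add]
  rw [h1, h3, h4]
  exact abs_integral_expMeasure_sub_le ha δ.2 haδ hlip

end

/-! ### The interpolated walk -/

theorem walk_succ' (y : ℕ → ℤ) (n : ℕ) :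
    walk y (n + 1) = y 0 + walk (fun t => y (t + 1)) n := by
  rw [walk, Finset.sum_range_succ', walk, add_comm]

theorem interp_walk_add_one (y : ℕ → ℤ) {u : ℝ} (hu : 0 ≤ u) :
    interp (walk y) (u + 1) = y 0 + interp (walk fun t => y (t + 1)) u := by
  simp only [interp, Nat.floor_add_one hu, walk_succ']
  push_cast
  ring

theorem interpWalk_apply (δ : ℝ) (y : ℕ → ℤ) (s : ℝ≥0) :
    interpWalk δ y s = δ * interp (walk y) (s / δ) := rfl

theorem interpWalk_zero (δ : ℝ) (y : ℕ → ℤ) : interpWalk δ y 0 = δ * y 0 := by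
  simp [interpWalk_apply, interp, walk]

theorem abs_interp_sub_interp_le {x : ℕ → ℝ} (hx : ∀ n, |x (n + 1) - x n| ≤ 1) {r s : ℝ}
    (hr : 0 ≤ r) (hrs : r ≤ s) : |interp x s - interp x r| ≤ s - r := by
  have key : ∀ (n : ℕ) (r s : ℝ), 0 ≤ r → r ≤ s → s ≤ n → |interp x s - interp x r| ≤ s - r := by
    intro n
    induction n with
    | zero =>
      intro r s hr hrs hs
      obtain rfl : r = s := le_antisymm hrs (by push_cast at hs; linarith)
      simp
    | succ n ih =>
      intro r s hr hrs hs
      push_cast at hs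
      have hstep : ∀ r s : ℝ, (n : ℝ) ≤ r → r ≤ s → s ≤ n + 1 →
          |interp x s - interp x r| ≤ s - r := by
        intro r s hr hrs hs
        rw [interp_eq_of_mem x n ⟨hr.trans hrs, hs⟩, interp_eq_of_mem x n ⟨hr, hrs.trans hs⟩,
          show x n + (s - n) * (x (n + 1) - x n) - (x n + (r - n) * (x (n + 1) - x n)) =
            (s - r) * (x (n + 1) - x n) by ring, abs_mul, abs_of_nonneg (sub_nonneg.2 hrs)]
        exact mul_le_of_le_one_right (sub_nonneg.2 hrs) (hx n)
      rcases le_total s n with hsn | hsn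
      · exact ih r s hr hrs hsn
      rcases le_total (n : ℝ) r with hrn | hrn
      · exact hstep r s hrn hrs hs
      · have h1 := ih r n hr hrn le_rfl
        have h2 := hstep n s le_rfl hsn hs
        have h3 := abs_sub_le (interp x s) (interp x n) (interp x r)
        linarith
  obtain ⟨n, hn⟩ := exists_nat_ge s
  exact key n r s hr hrs hn

theorem interpWalk_mem_lipPaths {δ r : ℝ} (hδ : 0 < δ) (hδr : δ ≤ r) {y : ℕ → ℤ}
    (hy : ∀ t, y t = -1 ∨ y t = 1) : interpWalk δ y ∈ lipPaths r := by
  have hy' : ∀ t, |(y t : ℝ)| = 1 := fun t => by rcases hy t with h | h <;> simp [h]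
  have hx : ∀ n, |walk y (n + 1) - walk y n| ≤ 1 := fun n => by
    rw [walk, Finset.sum_range_succ, walk, add_sub_cancel_left, hy']
  have hmono : ∀ s t : ℝ≥0, s ≤ t → |interpWalk δ y t - interpWalk δ y s| ≤ t - s := by
    intro s t hst
    rw [interpWalk_apply, interpWalk_apply, ← mul_sub, abs_mul, abs_of_pos hδ]
    have hst' : (s : ℝ) / δ ≤ t / δ := by gcongr
    have h := abs_interp_sub_interp_le hx (div_nonneg s.coe_nonneg hδ.le) hst'
    calc δ * |interp (walk y) (t / δ) - interp (walk y) (s / δ)| ≤ δ * (t / δ - s / δ) := by gcongr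
      _ = t - s := by field_simp
  refine ⟨by rw [interpWalk_zero, abs_mul, hy', abs_of_pos hδ, mul_one]; exact hδr, fun s t => ?_⟩
  rcases le_total s t with hst | hst
  · rw [abs_sub_comm, abs_sub_comm (s : ℝ), abs_of_nonneg (sub_nonneg.2 (NNReal.coe_le_coe.2 hst))]
    exact hmono s t hst
  · rw [abs_of_nonneg (sub_nonneg.2 (NNReal.coe_le_coe.2 hst))]
    exact hmono t s hst

theorem measurable_interpWalk {α : Type*} [MeasurableSpace α] (δ : ℝ) {Y : ℕ → α → ℤ}
    (hY : ∀ t, Measurable (Y t)) : Measurable fun ω => interpWalk δ fun t => Y t ω := by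
  have hw : ∀ n, Measurable fun ω => walk (fun t => Y t ω) n := fun n =>
    Finset.measurable_sum _ fun i _ =>
      (Measurable.of_discrete (f := fun k : ℤ => (k : ℝ))).comp (hY i)
  refine measurable_path fun s => ?_
  simp only [interpWalk_apply, interp]
  exact (((hw _).add (((hw _).sub (hw _)).const_mul _))).const_mul _

/-- The interpolated walk, translated so as to start from the origin. -/
noncomputable def centeredWalk (δ : ℝ) (y : ℕ → ℤ) : C(ℝ≥0, ℝ) :=
  interpWalk δ y - ContinuousMap.const _ (δ * y 0)

theorem centeredWalk_apply (δ : ℝ) (y : ℕ → ℤ) (s : ℝ≥0) :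
    centeredWalk δ y s = δ * interp (walk y) (s / δ) - δ * y 0 := rfl

/-- Since the walk starts at `Y_0`, its first slope is `y 1`, the second coordinate of the initial
pair. The value `y 0` enters only through the starting point, which the centering removes. -/
theorem centeredWalk_eq_glue {δ : ℝ≥0} (hδ : 0 < δ) (y : ℕ → ℤ) :
    centeredWalk δ y = glue δ (y 1) (centeredWalk δ fun t => y (t + 1)) := by
  have hδ' : (0 : ℝ) < δ := hδ
  ext s
  rw [glue_apply, centeredWalk_apply, centeredWalk_apply]
  rcases le_total s δ with hs | hs
  · have hs' : (s : ℝ) / δ ∈ Set.Icc ((0 : ℕ) : ℝ) ((0 : ℕ) + 1) := by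
      refine ⟨by rw [Nat.cast_zero]; positivity, ?_⟩
      rw [div_le_iff₀ hδ']
      simpa using hs
    rw [interp_eq_of_mem _ 0 hs', min_eq_left hs, tsub_eq_zero_of_le hs]
    simp [walk, interp, Finset.sum_range_succ]
    field_simp
    ring
  · rw [min_eq_right hs, NNReal.coe_sub hs]
    have h : (s : ℝ) / δ = (s - δ) / δ + 1 := by field_simp; ring
    rw [h, interp_walk_add_one y (div_nonneg (sub_nonneg.2 (NNReal.coe_le_coe.2 hs)) hδ'.le)]
    simp only [zero_add]
    ring

theorem measurable_centeredWalk {α : Type*} [MeasurableSpace α] (δ : ℝ) {Y : ℕ → α → ℤ}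
    (hY : ∀ t, Measurable (Y t)) : Measurable fun ω => centeredWalk δ fun t => Y t ω := by
  refine measurable_path fun s => ?_
  have h1 := (continuous_eval_const (F := C(ℝ≥0, ℝ)) s).measurable.comp (measurable_interpWalk δ hY)
  have h2 : Measurable fun ω => ((Y 0 ω : ℤ) : ℝ) :=
    (Measurable.of_discrete (f := fun k : ℤ => (k : ℝ))).comp (hY 0)
  exact h1.sub (h2.const_mul δ)

theorem centeredWalk_mem_lipPaths {δ : ℝ} (hδ : 0 < δ) {y : ℕ → ℤ}
    (hy : ∀ t, y t = -1 ∨ y t = 1) : centeredWalk δ y ∈ lipPaths 0 := by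
  refine ⟨?_, fun s t => ?_⟩
  · simp [centeredWalk, interpWalk_zero]
  · simpa [centeredWalk] using (interpWalk_mem_lipPaths hδ le_rfl hy).2 s t

/-! ### One step of an order-two chain -/

theorem pairState_injective : Function.Injective pairState := by decide

section

variable {Ω : Type*} [MeasurableSpace Ω] {M : Matrix (Fin 4) (Fin 4) ℝ} {Y : ℕ → Ω → ℤ}
  {P : Measure Ω} {i : Fin 4}

theorem measurableSet_pair_eq (hY : ∀ t, Measurable (Y t)) (t : ℕ) (i : Fin 4) :
    MeasurableSet {ω | (Y t ω, Y (t + 1) ω) = pairState i} :=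
  ((hY t).prodMk (hY (t + 1))) (measurableSet_singleton (pairState i))

theorem IsOrderTwoChain.measureReal_step [IsProbabilityMeasure P] (hY : IsOrderTwoChain M Y P)
    (hi : ∀ᵐ ω ∂P, (Y 0 ω, Y 1 ω) = pairState i) (j : Fin 4) :
    P.real {ω | (Y 1 ω, Y 2 ω) = pairState j} = M i j := by
  have h := hY.markov 0 fun t => Nat.casesOn t i fun _ => j
  have h1 : P.real {ω | ∀ t ≤ 0, (Y t ω, Y (t + 1) ω) =
      pairState (Nat.casesOn t i fun _ => j)} = 1 := by
    rw [← probReal_univ (μ := P)]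
    refine measureReal_congr ?_
    filter_upwards [hi] with ω hω
    refine propext ⟨fun _ => trivial, fun _ t ht => ?_⟩
    obtain rfl := Nat.le_zero.1 ht
    exact hω
  have h2 : P.real {ω | ∀ t ≤ 0 + 1, (Y t ω, Y (t + 1) ω) =
      pairState (Nat.casesOn t i fun _ => j)} = P.real {ω | (Y 1 ω, Y 2 ω) = pairState j} := by
    refine measureReal_congr ?_
    filter_upwards [hi] with ω hω
    refine propext ⟨fun h => h 1 le_rfl, fun h t ht => ?_⟩
    rcases t with _ | t
    · exact hω
    · obtain rfl : t = 0 := by omega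
      exact h
  rw [h1, h2, one_mul] at h
  exact h

/-- Prefixing the almost sure initial state `i` turns cylinders of the shifted chain into cylinders
of the original one, and the normalising factor is common to both sides. If `x 0 ≠ j`, both sides
vanish. -/
theorem IsOrderTwoChain.cond (hY : IsOrderTwoChain M Y P)
    (hi : ∀ᵐ ω ∂P, (Y 0 ω, Y 1 ω) = pairState i) (j : Fin 4) :
    IsOrderTwoChain M (fun t => Y (t + 1)) P[|{ω | (Y 1 ω, Y 2 ω) = pairState j}] := by
  have hA := measurableSet_pair_eq hY.measurable 1 j
  refine ⟨fun t => hY.measurable _, fun t => hY.mem _, fun n x => ?_⟩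
  have hcond : ∀ B : Set Ω, P[|{ω | (Y 1 ω, Y 2 ω) = pairState j}].real B =
      (P.real {ω | (Y 1 ω, Y 2 ω) = pairState j})⁻¹ *
        P.real ({ω | (Y 1 ω, Y 2 ω) = pairState j} ∩ B) := fun B => by
    rw [measureReal_def, cond_apply hA, ENNReal.toReal_mul, ENNReal.toReal_inv]
    rfl
  rw [hcond, hcond, mul_assoc]
  congr 1
  by_cases hx : x 0 = j
  · have key : ∀ m, P.real ({ω | (Y 1 ω, Y 2 ω) = pairState j} ∩
        {ω | ∀ t ≤ m, (Y (t + 1) ω, Y (t + 1 + 1) ω) = pairState (x t)}) =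
        P.real {ω | ∀ t ≤ m + 1, (Y t ω, Y (t + 1) ω) = pairState (Nat.casesOn t i x)} := by
      intro m
      refine measureReal_congr ?_
      filter_upwards [hi] with ω hω
      refine propext ⟨?_, fun h => ⟨?_, fun t ht => h (t + 1) (by omega)⟩⟩
      · rintro ⟨-, h⟩ (_ | t) ht
        · exact hω
        · exact h t (by omega)
      · have := h 1 (by omega)
        exact this.trans (congrArg _ hx)
    rw [key, key]
    exact hY.markov (n + 1) fun t => Nat.casesOn t i x
  · have key : ∀ m, {ω | (Y 1 ω, Y 2 ω) = pairState j} ∩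
        {ω | ∀ t ≤ m, (Y (t + 1) ω, Y (t + 1 + 1) ω) = pairState (x t)} = ∅ := by
      intro m
      refine Set.eq_empty_of_forall_notMem ?_
      rintro ω ⟨h, h'⟩
      exact hx (pairState_injective ((h' 0 (Nat.zero_le _)).symm.trans h))
    rw [key, key]
    simp

theorem exists_pairState_eq {y z : ℤ} (hy : y = -1 ∨ y = 1) (hz : z = -1 ∨ z = 1) :
    ∃ j, (y, z) = pairState j := by
  rcases hy with rfl | rfl <;> rcases hz with rfl | rfl
  exacts [⟨0, rfl⟩, ⟨1, rfl⟩, ⟨2, rfl⟩, ⟨3, rfl⟩]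

theorem IsOrderTwoChain.integral_eq_sum [IsProbabilityMeasure P] (hY : IsOrderTwoChain M Y P)
    (hi : ∀ᵐ ω ∂P, (Y 0 ω, Y 1 ω) = pairState i) {f : Ω → ℝ} (hf : Integrable f P) :
    ∫ ω, f ω ∂P = ∑ j, M i j * ∫ ω, f ω ∂P[|{ω | (Y 1 ω, Y 2 ω) = pairState j}] := by
  have hA := measurableSet_pair_eq hY.measurable 1
  have huniv : ⋃ j, {ω | (Y 1 ω, Y (1 + 1) ω) = pairState j} = Set.univ := by
    refine Set.eq_univ_of_forall fun ω => Set.mem_iUnion.2 ?_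
    exact exists_pairState_eq (hY.mem 1 ω) (hY.mem 2 ω)
  rw [← setIntegral_univ, ← huniv, integral_iUnion_fintype hA ?_ fun j => hf.integrableOn]
  · refine Finset.sum_congr rfl fun j _ => ?_
    rw [← hY.measureReal_step hi j, ProbabilityTheory.cond, integral_smul_measure,
      ENNReal.toReal_inv, ← Measure.real, smul_eq_mul]
    -- Conditioning on a null event carries no information, but such a term has weight 0 on both
    -- sides.
    rcases eq_or_ne (P.real {ω | (Y 1 ω, Y 2 ω) = pairState j}) 0 with h0 | h0
    · rw [h0, zero_mul]
      rw [measureReal_eq_zero_iff] at h0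
      exact setIntegral_measure_zero _ h0
    · rw [mul_inv_cancel_left₀ h0]
  · intro j k hjk
    refine Set.disjoint_left.2 fun ω h h' => hjk (pairState_injective ?_)
    exact h.symm.trans h'

/-- Errors propagate from one step to the next through the transition matrix. The hypothesis ranges
over all laws `Q`, because the chain continues under a conditioned measure. -/
theorem IsOrderTwoChain.abs_integral_sub_le [IsProbabilityMeasure P]
    (hY : IsOrderTwoChain M Y P) (hM : ∀ j, 0 ≤ M i j)
    (hi : ∀ᵐ ω ∂P, (Y 0 ω, Y 1 ω) = pairState i) {δ : ℝ≥0} (hδ : 0 < δ) {F : C(ℝ≥0, ℝ) → ℝ}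
    (hF : Continuous F) {T : ℝ} (hFT : HorizonLip T 1 F) (u err : Fin 4 → ℝ)
    (h : ∀ (j : Fin 4) (Q : Measure Ω) [IsProbabilityMeasure Q],
      IsOrderTwoChain M (fun t => Y (t + 1)) Q →
      (∀ᵐ ω ∂Q, (Y 1 ω, Y 2 ω) = pairState j) →
      |∫ ω, F (glue δ (pairState i).2 (centeredWalk δ fun t => Y (t + 1) ω)) ∂Q - u j| ≤ err j) :
    |∫ ω, F (centeredWalk δ fun t => Y t ω) ∂P - ∑ j, M i j * u j| ≤ ∑ j, M i j * err j := by
  have hint : Integrable (fun ω => F (centeredWalk δ fun t => Y t ω)) P :=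
    Integrable.of_bound (hF.measurable.comp
      (measurable_centeredWalk δ hY.measurable)).aestronglyMeasurable _ (ae_of_all _ fun ω =>
        hFT.abs_le (centeredWalk_mem_lipPaths hδ fun t => hY.mem t ω))
  rw [hY.integral_eq_sum hi hint, ← Finset.sum_sub_distrib]
  refine (Finset.abs_sum_le_sum_abs _ _).trans (Finset.sum_le_sum fun j _ => ?_)
  rw [← mul_sub, abs_mul, abs_of_nonneg (hM j)]
  rcases (hM j).eq_or_lt with h0 | h0
  · simp [← h0]
  refine mul_le_mul_of_nonneg_left ?_ (hM j)
  have hA := measurableSet_pair_eq hY.measurable 1 j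
  have hpos : P {ω | (Y 1 ω, Y 2 ω) = pairState j} ≠ 0 := by
    intro h1
    rw [← hY.measureReal_step hi j, measureReal_def, h1] at h0
    simp at h0
  have := cond_isProbabilityMeasure hpos
  have hstart : ∀ᵐ ω ∂P[|{ω | (Y 1 ω, Y 2 ω) = pairState j}], (Y 1 ω, Y 2 ω) = pairState j :=
    ae_cond_mem hA
  have hj := h j P[|{ω | (Y 1 ω, Y 2 ω) = pairState j}] (hY.cond hi j) hstart
  rw [integral_congr_ae (g := fun ω =>
    F (glue δ (pairState i).2 (centeredWalk δ fun t => Y (t + 1) ω)))]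
  · exact hj
  · filter_upwards [cond_absolutelyContinuous.ae_le hi] with ω hω
    rw [centeredWalk_eq_glue hδ, ← congrArg Prod.snd hω]

end

/-! ### Convergence of the expectations -/

theorem integrable_smul_telegraph {v a b T : ℝ} {F : C(ℝ≥0, ℝ) → ℝ} (hF : Continuous F)
    (hFT : HorizonLip T 1 F) (hv : |v| = 1) :
    Integrable (fun e => F (v • telegraph a b e)) expSeqMeasure :=
  Integrable.of_bound (hF.measurable.comp (measurable_smul_telegraph _ _ _)).aestronglyMeasurable _
    (ae_of_all _ fun e => hFT.abs_le (smul_telegraph_mem_lipPaths hv e))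

theorem abs_telegraphMean_sub_glue_le {v w a b T : ℝ} {F : C(ℝ≥0, ℝ) → ℝ} (hF : Continuous F)
    (hT : 0 ≤ T) (hFT : HorizonLip T 1 F) (hv : |v| = 1) (hw : |w| = 1) (δ : ℝ≥0) :
    |telegraphMean v a b F - telegraphMean v a b fun f => F (glue δ w f)| ≤ 2 * δ := by
  have hFT' : HorizonLip T 1 fun f => F (glue δ w f) :=
    (hFT.mono (le_add_of_nonneg_right δ.2) (add_nonneg hT δ.2) le_rfl).comp_glue δ w hT
  have hb : ∀ᵐ e ∂expSeqMeasure,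
      ‖F (v • telegraph a b e) - F (glue δ w (v • telegraph a b e))‖ ≤ 2 * δ := by
    refine ae_of_all _ fun e => ?_
    simpa [glue_zero] using
      hFT.abs_sub_glue_le (smul_telegraph_mem_lipPaths (a := a) (b := b) hv e) hw 0 δ
  have hint' : Integrable (fun e => F (glue δ w (v • telegraph a b e))) expSeqMeasure :=
    integrable_smul_telegraph (hF.comp (continuous_glue δ w)) hFT' hv
  rw [telegraphMean, telegraphMean, ← integral_sub (integrable_smul_telegraph hF hFT hv) hint']
  simpa using norm_integral_le_of_norm_le_const hb

/-- The expectation of `F` at the limit process, as a function of the initial pair state. -/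
noncomputable def pairMean (v₀ v₁ a₀ a₁ : ℝ) (F : C(ℝ≥0, ℝ) → ℝ) : Fin 4 → ℝ :=
  ![telegraphMean (-1) a₀ a₁ F,
    v₀ * telegraphMean 1 a₁ a₀ F + (1 - v₀) * telegraphMean (-1) a₀ a₁ F,
    v₁ * telegraphMean (-1) a₀ a₁ F + (1 - v₁) * telegraphMean 1 a₁ a₀ F,
    telegraphMean 1 a₁ a₀ F]

theorem abs_mix_sub_mix_le {v x y x' y' η : ℝ} (hv : 0 ≤ v) (hv' : v ≤ 1) (hx : |x - x'| ≤ η)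
    (hy : |y - y'| ≤ η) : |v * x + (1 - v) * y - (v * x' + (1 - v) * y')| ≤ η := by
  rw [abs_le] at *
  constructor <;> nlinarith

/-- The error bounds for the four initial pair states. -/
noncomputable def stepError (κ p δ : ℝ) (n : ℕ) : Fin 4 → ℝ :=
  ![n * κ * δ ^ 2, n * κ * δ ^ 2 + 2 * δ / p, n * κ * δ ^ 2 + 2 * δ / p, n * κ * δ ^ 2]

theorem sum_pairMatrix_mul (c₀ c₁ p₀ p₁ δ : ℝ) (w : Fin 4 → ℝ) (i : Fin 4) :
    ∑ j, pairMatrix c₀ c₁ p₀ p₁ δ i j * w j =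
      ![(1 - c₀ * δ) * w 0 + c₀ * δ * w 1, (1 - p₀) * w 2 + p₀ * w 3,
        p₁ * w 0 + (1 - p₁) * w 1, c₁ * δ * w 2 + (1 - c₁ * δ) * w 3] i := by
  fin_cases i <;> simp [pairMatrix, Fin.sum_univ_four]

section

variable {c₀ c₁ p₀ p₁ v₀ v₁ c₀' c₁' : ℝ}

/-- In the alternating states the absorption weights are harmonic, so the recursion is exact for the
glued functional and the only cost is the `2 * δ` of the gluing. In the slow states, leaving with
probability `c₀ * δ` and then switching with probability `v₀` reproduces the flip probability `c₀' *
δ` of the telegraph step, and likewise for `c₁'`. -/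
theorem abs_pairMean_sub_le (hc₀ : 0 < c₀) (hc₁ : 0 < c₁) (hp₀ : 0 < p₀) (hp₀' : p₀ < 1)
    (hp₁ : 0 < p₁) (hp₁' : p₁ < 1) (hv₀ : v₀ = absorb p₀ p₁ p₀) (hv₁ : v₁ = absorb p₀ p₁ p₁)
    (hc₀' : c₀' = c₀ * v₀) (hc₁' : c₁' = c₁ * v₁) {δ : ℝ≥0} (hδ₀ : c₀ * δ < 1) (hδ₁ : c₁ * δ < 1)
    {F : C(ℝ≥0, ℝ) → ℝ} (hF : Continuous F) {T : ℝ} (hT : 0 ≤ T) (hFT : HorizonLip T 1 F)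
    (i : Fin 4) :
    |∑ j, pairMatrix c₀ c₁ p₀ p₁ δ i j *
      pairMean v₀ v₁ c₀' c₁' (fun f => F (glue δ (pairState i).2 f)) j -
      pairMean v₀ v₁ c₀' c₁' F i| ≤
      ![4 * c₀' * (δ : ℝ) ^ 2, 2 * (δ : ℝ), 2 * (δ : ℝ), 4 * c₁' * (δ : ℝ) ^ 2] i := by
  have hD : 0 < 1 - (1 - p₀) * (1 - p₁) := by nlinarith
  have hv₀0 : 0 < v₀ := by rw [hv₀]; exact div_pos hp₀ hD
  have hv₁0 : 0 < v₁ := by rw [hv₁]; exact div_pos hp₁ hD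
  have hv₀D : v₀ * (1 - (1 - p₀) * (1 - p₁)) = p₀ := by
    rw [hv₀, absorb, div_mul_cancel₀ _ hD.ne']
  have hv₁D : v₁ * (1 - (1 - p₀) * (1 - p₁)) = p₁ := by
    rw [hv₁, absorb, div_mul_cancel₀ _ hD.ne']
  have hv₀1 : v₀ ≤ 1 := by rw [hv₀]; exact (div_le_one hD).2 (by nlinarith)
  have hv₁1 : v₁ ≤ 1 := by rw [hv₁]; exact (div_le_one hD).2 (by nlinarith)
  -- The first-step equations for the absorption probabilities: to end in `(-1,-1)` from `(-1,1)`,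
  -- the chain must move to `(1,-1)` and end there from that state; symmetrically for the other.
  have hv₀₁ : (1 - p₀) * v₁ = 1 - v₀ :=
    mul_right_cancel₀ hD.ne' (by linear_combination (1 - p₀) * hv₁D + hv₀D)
  have hv₁₀ : (1 - p₁) * v₀ = 1 - v₁ :=
    mul_right_cancel₀ hD.ne' (by linear_combination (1 - p₁) * hv₀D + hv₁D)
  have hc₀'0 : 0 < c₀' := hc₀' ▸ mul_pos hc₀ hv₀0
  have hc₁'0 : 0 < c₁' := hc₁' ▸ mul_pos hc₁ hv₁0
  have hle₀ : c₀' * δ ≤ 1 := by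
    rw [hc₀']
    nlinarith [mul_nonneg hc₀.le δ.coe_nonneg]
  have hle₁ : c₁' * δ ≤ 1 := by
    rw [hc₁']
    nlinarith [mul_nonneg hc₁.le δ.coe_nonneg]
  rw [sum_pairMatrix_mul, abs_sub_comm]
  fin_cases i
  · have h := abs_telegraphMean_sub_le hF hT hFT (v := -1) (by simp) hc₀'0 hc₁'0 δ hle₀
    rw [neg_neg] at h
    simp only [pairMean, pairState, Fin.zero_eta, Matrix.cons_val, Int.cast_neg, Int.cast_one]
    convert h using 2
    rw [hc₀']
    ring
  · have h1 := abs_telegraphMean_sub_glue_le (a := c₁') (b := c₀') hF hT hFT (v := 1) (w := 1)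
      (by simp) (by simp) δ
    have h2 := abs_telegraphMean_sub_glue_le (a := c₀') (b := c₁') hF hT hFT (v := -1) (w := 1)
      (by simp) (by simp) δ
    simp only [pairMean, pairState, Fin.mk_one, Matrix.cons_val, Int.cast_one]
    convert abs_mix_sub_mix_le hv₀0.le hv₀1 h1 h2 using 3
    linear_combination (telegraphMean (-1) c₀' c₁' (fun f => F (glue δ 1 f)) -
      telegraphMean 1 c₁' c₀' fun f => F (glue δ 1 f)) * hv₀₁
  · have h1 := abs_telegraphMean_sub_glue_le (a := c₁') (b := c₀') hF hT hFT (v := 1) (w := -1)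
      (by simp) (by simp) δ
    have h2 := abs_telegraphMean_sub_glue_le (a := c₀') (b := c₁') hF hT hFT (v := -1) (w := -1)
      (by simp) (by simp) δ
    simp only [pairMean, pairState, Fin.reduceFinMk, Matrix.cons_val, Int.cast_neg,
      Int.cast_one]
    convert abs_mix_sub_mix_le hv₁0.le hv₁1 h2 h1 using 3
    linear_combination (telegraphMean 1 c₁' c₀' (fun f => F (glue δ (-1) f)) -
      telegraphMean (-1) c₀' c₁' fun f => F (glue δ (-1) f)) * hv₁₀
  · have h := abs_telegraphMean_sub_le hF hT hFT (v := 1) (by simp) hc₁'0 hc₀'0 δ hle₁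
    simp only [pairMean, pairState, Fin.reduceFinMk, Matrix.cons_val, Int.cast_one]
    convert h using 2
    rw [hc₁']
    ring

theorem pairMatrix_nonneg (hc₀ : 0 < c₀) (hc₁ : 0 < c₁) (hp₀ : 0 < p₀) (hp₀' : p₀ < 1)
    (hp₁ : 0 < p₁) (hp₁' : p₁ < 1) {δ : ℝ≥0} (hδ₀ : c₀ * δ < 1) (hδ₁ : c₁ * δ < 1) (i j : Fin 4) :
    0 ≤ pairMatrix c₀ c₁ p₀ p₁ δ i j := by
  have h₀ := mul_nonneg hc₀.le δ.coe_nonneg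
  have h₁ := mul_nonneg hc₁.le δ.coe_nonneg
  fin_cases i <;> fin_cases j <;> simp [pairMatrix] <;> first | assumption | linarith

/-- Induction on the horizon counted in steps, quantified over all starting states, laws and
functionals. The profile `stepError` is a supersolution of the error recursion: its `O(δ)` part sits
only on the alternating states and does not grow with `n`. -/
theorem abs_integral_centeredWalk_sub_le (hc₀ : 0 < c₀) (hc₁ : 0 < c₁) (hp₀ : 0 < p₀)
    (hp₀' : p₀ < 1) (hp₁ : 0 < p₁) (hp₁' : p₁ < 1) (hv₀ : v₀ = absorb p₀ p₁ p₀)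
    (hv₁ : v₁ = absorb p₀ p₁ p₁) (hc₀' : c₀' = c₀ * v₀) (hc₁' : c₁' = c₁ * v₁) {p κ : ℝ}
    (hp : 0 < p) (hpp₀ : p ≤ p₀) (hpp₁ : p ≤ p₁) (hκ : 0 ≤ κ) (hκ₀ : 4 * c₀' + 2 * c₀ / p ≤ κ)
    (hκ₁ : 4 * c₁' + 2 * c₁ / p ≤ κ) {δ : ℝ≥0} (hδ : 0 < δ) (hδ₀ : c₀ * δ < 1) (hδ₁ : c₁ * δ < 1)
    {Ω : Type*} [MeasurableSpace Ω] (n : ℕ) {Y : ℕ → Ω → ℤ} {P : Measure Ω}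
    [IsProbabilityMeasure P] (hY : IsOrderTwoChain (pairMatrix c₀ c₁ p₀ p₁ δ) Y P) {i : Fin 4}
    (hi : ∀ᵐ ω ∂P, (Y 0 ω, Y 1 ω) = pairState i) {F : C(ℝ≥0, ℝ) → ℝ} (hF : Continuous F)
    (hFT : HorizonLip (n * δ) 1 F) :
    |∫ ω, F (centeredWalk δ fun t => Y t ω) ∂P - pairMean v₀ v₁ c₀' c₁' F i| ≤
      stepError κ p δ n i := by
  have hδ' : (0 : ℝ) < δ := hδ
  induction n generalizing Y P i F with
  | zero =>
    -- At horizon 0 the functional sees only the starting point, which is the origin for every path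
    -- involved.
    have hconst : ∀ f ∈ lipPaths 0, F f = F 0 := by
      intro f hf
      have h0 : f 0 = 0 := abs_nonpos_iff.1 hf.1
      have := hFT f 0 0 fun s hs => by
        have hs0 : s = 0 := NNReal.coe_eq_zero.1 (le_antisymm (by simpa using hs) s.coe_nonneg)
        simp [hs0, h0]
      rw [mul_zero] at this
      exact sub_eq_zero.1 (abs_nonpos_iff.1 this)
    have h1 : ∀ {v a b : ℝ}, |v| = 1 → telegraphMean v a b F = F 0 := fun hv => by
      rw [telegraphMean]
      simp [hconst _ (smul_telegraph_mem_lipPaths hv _)]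
    have h2 : ∀ ω, F (centeredWalk δ fun t => Y t ω) = F 0 := fun ω =>
      hconst _ (centeredWalk_mem_lipPaths hδ fun t => hY.mem t ω)
    have h3 : pairMean v₀ v₁ c₀' c₁' F i = F 0 := by
      rw [pairMean, h1 (by simp), h1 (by simp)]
      fin_cases i <;> simp <;> ring
    have h4 : 0 ≤ 2 * (δ : ℝ) / p := by positivity
    simp only [h2, h3, integral_const, probReal_univ, one_smul, sub_self, abs_zero]
    fin_cases i <;> simp [stepError, h4]
  | succ n ih =>
    have hw : |(((pairState i).2 : ℤ) : ℝ)| = 1 := by fin_cases i <;> simp [pairState]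
    have hFT' : HorizonLip (n * δ) 1 fun f => F (glue δ (pairState i).2 f) := by
      refine HorizonLip.comp_glue δ _ ?_ (by positivity)
      convert hFT using 1
      push_cast
      ring
    have hstep := hY.abs_integral_sub_le
      (pairMatrix_nonneg hc₀ hc₁ hp₀ hp₀' hp₁ hp₁' hδ₀ hδ₁ i) hi hδ hF hFT
      (pairMean v₀ v₁ c₀' c₁' fun f => F (glue δ (pairState i).2 f)) (stepError κ p δ n)
      fun j Q _ hQ hj => ih hQ hj (hF.comp (continuous_glue δ _)) hFT'
    have hcons := abs_pairMean_sub_le hc₀ hc₁ hp₀ hp₀' hp₁ hp₁' hv₀ hv₁ hc₀' hc₁' hδ₀ hδ₁ hF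
      (show 0 ≤ ((n + 1 : ℕ) : ℝ) * δ by positivity) hFT i
    refine (abs_sub_le _ _ _).trans ((add_le_add hstep hcons).trans ?_)
    rw [sum_pairMatrix_mul]
    -- A slow state pays its own defect plus the probability `c₀ * δ` of entering an alternating
    -- state times the extra error `2 * δ / p` there. The constant `κ` is chosen to cover both.
    have e0 : 4 * c₀' * (δ : ℝ) ^ 2 + c₀ * δ * (2 * δ / p) ≤ κ * (δ : ℝ) ^ 2 := by
      calc 4 * c₀' * (δ : ℝ) ^ 2 + c₀ * δ * (2 * δ / p)
          = (4 * c₀' + 2 * c₀ / p) * (δ : ℝ) ^ 2 := by ring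
        _ ≤ κ * (δ : ℝ) ^ 2 := by gcongr
    have e3 : 4 * c₁' * (δ : ℝ) ^ 2 + c₁ * δ * (2 * δ / p) ≤ κ * (δ : ℝ) ^ 2 := by
      calc 4 * c₁' * (δ : ℝ) ^ 2 + c₁ * δ * (2 * δ / p)
          = (4 * c₁' + 2 * c₁ / p) * (δ : ℝ) ^ 2 := by ring
        _ ≤ κ * (δ : ℝ) ^ 2 := by gcongr
    -- An alternating state is left for a slow one with probability at least `p`. The extra error `2
    -- * δ / p` thus drops by at least `2 * δ` in one step, which pays for the defect there.
    have hfast : ∀ q, p ≤ q → 2 * (δ : ℝ) ≤ q * (2 * δ / p) := fun q hq => by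
      rw [mul_div_assoc', le_div_iff₀ hp]
      nlinarith
    have e1 := hfast p₀ hpp₀
    have e2 := hfast p₁ hpp₁
    have e4 : 0 ≤ κ * (δ : ℝ) ^ 2 := by positivity
    fin_cases i <;> simp only [stepError, Fin.zero_eta, Fin.mk_one, Fin.reduceFinMk,
      Matrix.cons_val, Nat.cast_add, Nat.cast_one] <;> nlinarith

end

/-! ### Convergence in distribution -/

theorem stepSize_coe_pos {c₀ c₁ : ℝ} (δ : StepSize c₀ c₁) : 0 < δ.1 := δ.2.1

theorem tendsto_stepSize_coe (c₀ c₁ : ℝ) :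
    Tendsto (fun δ : StepSize c₀ c₁ => δ.1) (stepToZero c₀ c₁) (𝓝 0) := tendsto_comap

theorem abs_integral_interpWalk_sub_centeredWalk_le {Ω : Type*} [MeasurableSpace Ω]
    {P : Measure Ω} [IsProbabilityMeasure P] {Y : ℕ → Ω → ℤ} (hm : ∀ t, Measurable (Y t))
    (hy : ∀ t ω, Y t ω = -1 ∨ Y t ω = 1) {δ : ℝ} (hδ : 0 < δ) {F : C(ℝ≥0, ℝ) → ℝ}
    (hF : Continuous F) {T : ℝ} (hFT : HorizonLip T 1 F) :
    |∫ ω, F (interpWalk δ fun t => Y t ω) ∂P - ∫ ω, F (centeredWalk δ fun t => Y t ω) ∂P| ≤ δ := by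
  have h1 : Integrable (fun ω => F (interpWalk δ fun t => Y t ω)) P :=
    Integrable.of_bound (hF.measurable.comp (measurable_interpWalk δ hm)).aestronglyMeasurable _
      (ae_of_all _ fun ω => hFT.abs_le (interpWalk_mem_lipPaths hδ le_rfl fun t => hy t ω))
  have h2 : Integrable (fun ω => F (centeredWalk δ fun t => Y t ω)) P :=
    Integrable.of_bound (hF.measurable.comp (measurable_centeredWalk δ hm)).aestronglyMeasurable _
      (ae_of_all _ fun ω => hFT.abs_le (centeredWalk_mem_lipPaths hδ fun t => hy t ω))
  have h3 : ∀ᵐ ω ∂P,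
      ‖F (interpWalk δ fun t => Y t ω) - F (centeredWalk δ fun t => Y t ω)‖ ≤ δ := by
    refine ae_of_all _ fun ω => ?_
    refine (hFT _ _ δ fun s _ => ?_).trans_eq (one_mul δ)
    have hy0 : |((Y 0 ω : ℤ) : ℝ)| = 1 := by rcases hy 0 ω with h | h <;> simp [h]
    simp [centeredWalk, abs_mul, hy0, abs_of_pos hδ]
  rw [← integral_sub h1 h2]
  simpa using norm_integral_le_of_norm_le_const h3

section

variable {c₀ c₁ p₀ p₁ v₀ v₁ c₀' c₁' : ℝ}

/-- Convergence of the walk started from the pair state `i`, to any random Lipschitz path with the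
expected means. -/
theorem tendstoInDistribution_interpWalk (hc₀ : 0 < c₀) (hc₁ : 0 < c₁) (hp₀ : 0 < p₀)
    (hp₀' : p₀ < 1) (hp₁ : 0 < p₁) (hp₁' : p₁ < 1) (hv₀ : v₀ = absorb p₀ p₁ p₀)
    (hv₁ : v₁ = absorb p₀ p₁ p₁) (hc₀' : c₀' = c₀ * v₀) (hc₁' : c₁' = c₁ * v₁)
    {Ω : StepSize c₀ c₁ → Type*} [∀ δ, MeasurableSpace (Ω δ)] {P : ∀ δ, Measure (Ω δ)}
    [∀ δ, IsProbabilityMeasure (P δ)] {Y : ∀ δ, ℕ → Ω δ → ℤ}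
    (hY : ∀ δ, IsOrderTwoChain (pairMatrix c₀ c₁ p₀ p₁ δ.1) (Y δ) (P δ)) (i : Fin 4)
    (hi : ∀ δ, ∀ᵐ ω ∂(P δ), (Y δ 0 ω, Y δ 1 ω) = pairState i)
    {Ω' : Type*} [MeasurableSpace Ω'] {P' : Measure Ω'} [IsProbabilityMeasure P']
    {Z : Ω' → C(ℝ≥0, ℝ)} (hZ : AEMeasurable Z P') (hZl : ∀ᵐ ω ∂P', Z ω ∈ lipPaths 0)
    (hmean : ∀ (F : C(ℝ≥0, ℝ) → ℝ) (T : ℝ), Continuous F → HorizonLip T 1 F →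
      ∫ ω, F (Z ω) ∂P' = pairMean v₀ v₁ c₀' c₁' F i) :
    TendstoInDistribution (fun δ ω => interpWalk δ.1 (fun t => Y δ t ω)) (stepToZero c₀ c₁)
      Z P P' := by
  have hsmall : ∀ᶠ δ : StepSize c₀ c₁ in stepToZero c₀ c₁, δ.1 ≤ 1 :=
    ((tendsto_stepSize_coe c₀ c₁).eventually_lt_const zero_lt_one).mono fun _ h => h.le
  refine tendstoInDistribution_of_horizonLip
    (fun δ => (measurable_interpWalk δ.1 (hY δ).measurable).aemeasurable) hZ 1 ?_ ?_ ?_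
  · filter_upwards [hsmall] with δ hδ
    exact ae_of_all _ fun ω =>
      interpWalk_mem_lipPaths (stepSize_coe_pos δ) hδ fun t => (hY δ).mem t ω
  · filter_upwards [hZl] with ω hω
    exact ⟨hω.1.trans zero_le_one, hω.2⟩
  intro F T hT hFT
  rw [hmean F T F.continuous hFT]
  set p := min p₀ p₁ with hp
  set κ := max 0 (max (4 * c₀' + 2 * c₀ / p) (4 * c₁' + 2 * c₁ / p)) with hκ
  have hp0 : 0 < p := lt_min hp₀ hp₁
  have hκ0 : 0 ≤ κ := le_max_left _ _
  have hbound : ∀ δ : StepSize c₀ c₁, |∫ ω, F (interpWalk δ.1 fun t => Y δ t ω) ∂(P δ) -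
      pairMean v₀ v₁ c₀' c₁' F i| ≤ δ.1 + ((T + δ.1) * κ * δ.1 + 2 * δ.1 / p) := by
    intro δ
    have hδ := stepSize_coe_pos δ
    -- The least number of steps that covers the horizon; the overshoot is at most one step.
    set n := ⌈T / δ.1⌉₊ with hn
    have hn1 : T ≤ n * δ.1 := by
      rw [← div_le_iff₀ hδ]
      exact Nat.le_ceil _
    have hn2 : n * δ.1 ≤ T + δ.1 := by
      have := (Nat.ceil_lt_add_one (div_nonneg hT hδ.le)).le
      calc n * δ.1 ≤ (T / δ.1 + 1) * δ.1 := by gcongr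
        _ = T + δ.1 := by field_simp
    have h1 := abs_integral_interpWalk_sub_centeredWalk_le (P := P δ) (hY δ).measurable
      (hY δ).mem hδ F.continuous hFT
    have h2 : |∫ ω, F (centeredWalk δ.1 fun t => Y δ t ω) ∂(P δ) -
        pairMean v₀ v₁ c₀' c₁' F i| ≤ stepError κ p δ.1 n i :=
      abs_integral_centeredWalk_sub_le hc₀ hc₁ hp₀ hp₀' hp₁ hp₁' hv₀ hv₁ hc₀' hc₁' hp0
        (min_le_left _ _) (min_le_right _ _) hκ0
        ((le_max_left _ _).trans (le_max_right _ _)) ((le_max_right _ _).trans (le_max_right _ _))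
        (δ := ⟨δ.1, hδ.le⟩) hδ δ.2.2.1 δ.2.2.2 n (hY δ) (hi δ) F.continuous
        (hFT.mono hn1 (hT.trans hn1) le_rfl)
    have h3 : n * κ * δ.1 ^ 2 ≤ (T + δ.1) * κ * δ.1 := by
      calc n * κ * δ.1 ^ 2 = n * δ.1 * κ * δ.1 := by ring
        _ ≤ (T + δ.1) * κ * δ.1 := by gcongr
    have h4 : 0 ≤ 2 * δ.1 / p := by positivity
    have h5 : stepError κ p δ.1 n i ≤ (T + δ.1) * κ * δ.1 + 2 * δ.1 / p := by
      fin_cases i <;> simp [stepError] <;> linarith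
    exact (abs_sub_le _ _ _).trans (add_le_add h1 (h2.trans h5))
  have hlim : Tendsto (fun δ : StepSize c₀ c₁ => δ.1 + ((T + δ.1) * κ * δ.1 + 2 * δ.1 / p))
      (stepToZero c₀ c₁) (𝓝 0) := by
    have hc : Tendsto (fun x : ℝ => x + ((T + x) * κ * x + 2 * x / p)) (𝓝 0) (𝓝 0) := by
      have : Continuous fun x : ℝ => x + ((T + x) * κ * x + 2 * x / p) := by fun_prop
      simpa using this.tendsto 0
    exact hc.comp (tendsto_stepSize_coe c₀ c₁)
  rw [tendsto_iff_dist_tendsto_zero]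
  exact squeeze_zero (fun _ => dist_nonneg) hbound hlim

end

/-! ### Laws of the limit processes: a single telegraph noise and the mixture by `ε` -/

section

variable {Ω' : Type*} [MeasurableSpace Ω'] {P' : Measure Ω'} {e : ℕ → Ω' → ℝ}

theorem IsStdExpSequence.aemeasurable (he : IsStdExpSequence e P') :
    AEMeasurable (fun ω k => e k ω) P' :=
  aemeasurable_pi_iff.2 fun k => (he.hasLaw k).aemeasurable

theorem IsStdExpSequence.map_eq (he : IsStdExpSequence e P') :
    P'.map (fun ω k => e k ω) = expSeqMeasure := by
  rw [he.indep.map_fun_eq_infinitePi_map₀' fun k => (he.hasLaw k).aemeasurable, expSeqMeasure]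
  congr 1
  ext1 k
  exact (he.hasLaw k).map_eq

theorem IsStdExpSequence.integral_eq_telegraphMean (he : IsStdExpSequence e P') (v a b : ℝ)
    {F : C(ℝ≥0, ℝ) → ℝ} (hF : Continuous F) :
    ∫ ω, F (v • telegraph a b fun k => e k ω) ∂P' = telegraphMean v a b F := by
  have hm : Measurable fun s => F (v • telegraph a b s) :=
    hF.measurable.comp (measurable_smul_telegraph v a b)
  rw [telegraphMean, ← he.map_eq, integral_map he.aemeasurable hm.aestronglyMeasurable]

theorem IsStdExpSequence.aemeasurable_smul_telegraph (he : IsStdExpSequence e P') (v a b : ℝ) :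
    AEMeasurable (fun ω => v • telegraph a b fun k => e k ω) P' :=
  (measurable_smul_telegraph v a b).comp_aemeasurable he.aemeasurable

theorem IsStdExpSequence.setIntegral_eq_mul_telegraphMean (he : IsStdExpSequence e P')
    {ε : Ω' → ℝ} (hε : Measurable ε) (hind : IndepFun ε (fun ω k => e k ω) P') (x v a b : ℝ)
    {F : C(ℝ≥0, ℝ) → ℝ} (hF : Continuous F) :
    ∫ ω in {ω | ε ω = x}, F (v • telegraph a b fun k => e k ω) ∂P' =
      P'.real {ω | ε ω = x} * telegraphMean v a b F := by
  have hx : MeasurableSet {ω | ε ω = x} := hε (measurableSet_singleton x)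
  have h := hind.integral_fun_comp_mul_comp (f := Set.indicator {x} fun _ => (1 : ℝ))
    (g := fun s => F (v • telegraph a b s)) hε.aemeasurable he.aemeasurable
    ((measurable_const.indicator (measurableSet_singleton x)).aestronglyMeasurable)
    (hF.measurable.comp (measurable_smul_telegraph v a b)).aestronglyMeasurable
  have hind' : ∀ ω, Set.indicator {x} (fun _ => (1 : ℝ)) (ε ω) =
      Set.indicator {ω | ε ω = x} (fun _ => (1 : ℝ)) ω := fun ω => rfl
  rw [he.integral_eq_telegraphMean v a b hF] at h
  simp only [hind', integral_indicator_const _ hx, smul_eq_mul, mul_one] at h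
  rw [← h, ← integral_indicator hx]
  refine integral_congr_ae (ae_of_all _ fun ω => ?_)
  by_cases hω : ε ω = x <;> simp [hω]

variable {e' : ℕ → Ω' → ℝ} {ε : Ω' → ℝ} {a₀ a₁ : ℝ}

theorem ae_eq_zero_or_one [IsProbabilityMeasure P'] (hε : Measurable ε)
    (h : P'.real {ω | ε ω = 0} + P'.real {ω | ε ω = 1} = 1) : ∀ᵐ ω ∂P', ε ω = 0 ∨ ε ω = 1 := by
  have h0 : MeasurableSet {ω | ε ω = 0} := hε (measurableSet_singleton 0)
  have h1 : MeasurableSet {ω | ε ω = 1} := hε (measurableSet_singleton 1)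
  have hd : Disjoint {ω | ε ω = 0} {ω | ε ω = 1} :=
    Set.disjoint_left.2 fun ω (h : ε ω = 0) (h' : ε ω = 1) => zero_ne_one (h.symm.trans h')
  rw [← measureReal_union hd h1] at h
  refine (mem_ae_iff_prob_eq_one (h0.union h1)).2 ?_
  rwa [measureReal_def, ENNReal.toReal_eq_one_iff] at h

theorem aemeasurable_mixture (he : IsStdExpSequence e P') (he' : IsStdExpSequence e' P')
    (hε : Measurable ε) : AEMeasurable (fun ω => (ε ω - 1) • telegraph a₀ a₁ (fun k => e k ω) +
      ε ω • telegraph a₁ a₀ (fun k => e' k ω)) P' := by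
  have hG : Measurable fun q : ℝ × (ℕ → ℝ) × (ℕ → ℝ) =>
      (q.1 - 1) • telegraph a₀ a₁ q.2.1 + q.1 • telegraph a₁ a₀ q.2.2 := by
    refine measurable_path fun s => ?_
    have hs : ∀ a b, Measurable fun x => telegraph a b x s := fun a b =>
      (continuous_eval_const (F := C(ℝ≥0, ℝ)) s).measurable.comp (measurable_telegraph a b)
    simp only [ContinuousMap.add_apply, ContinuousMap.smul_apply, smul_eq_mul]
    exact ((measurable_fst.sub_const 1).mul ((hs _ _).comp measurable_snd.fst)).add
      (measurable_fst.mul ((hs _ _).comp measurable_snd.snd))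
  exact hG.comp_aemeasurable
    (hε.aemeasurable.prodMk (he.aemeasurable.prodMk he'.aemeasurable))

theorem mixture_mem_lipPaths [IsProbabilityMeasure P'] (hε : Measurable ε)
    (h : P'.real {ω | ε ω = 0} + P'.real {ω | ε ω = 1} = 1) :
    ∀ᵐ ω ∂P', (ε ω - 1) • telegraph a₀ a₁ (fun k => e k ω) +
      ε ω • telegraph a₁ a₀ (fun k => e' k ω) ∈ lipPaths 0 := by
  filter_upwards [ae_eq_zero_or_one hε h] with ω hω
  rcases hω with hω | hω
  · rw [hω, zero_smul, add_zero, zero_sub]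
    exact smul_telegraph_mem_lipPaths (by simp) _
  · rw [hω, sub_self, zero_smul, zero_add]
    exact smul_telegraph_mem_lipPaths (by simp) _

/-- On each of the events `ε = 0` and `ε = 1` only one of the two sequences is present. Independence
of `ε` from each sequence separately is therefore enough, and their joint law plays no role. -/
theorem integral_mixture [IsProbabilityMeasure P'] (he : IsStdExpSequence e P')
    (he' : IsStdExpSequence e' P') (hε : Measurable ε) (hind : IndepFun ε (fun ω k => e k ω) P')
    (hind' : IndepFun ε (fun ω k => e' k ω) P')
    (h : P'.real {ω | ε ω = 0} + P'.real {ω | ε ω = 1} = 1) {F : C(ℝ≥0, ℝ) → ℝ} {T : ℝ}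
    (hF : Continuous F) (hFT : HorizonLip T 1 F) :
    ∫ ω, F ((ε ω - 1) • telegraph a₀ a₁ (fun k => e k ω) +
      ε ω • telegraph a₁ a₀ (fun k => e' k ω)) ∂P' =
      P'.real {ω | ε ω = 0} * telegraphMean (-1) a₀ a₁ F +
        P'.real {ω | ε ω = 1} * telegraphMean 1 a₁ a₀ F := by
  have h0 : MeasurableSet {ω | ε ω = 0} := hε (measurableSet_singleton 0)
  have h1 : MeasurableSet {ω | ε ω = 1} := hε (measurableSet_singleton 1)
  have hd : Disjoint {ω | ε ω = 0} {ω | ε ω = 1} :=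
    Set.disjoint_left.2 fun ω (h : ε ω = 0) (h' : ε ω = 1) => zero_ne_one (h.symm.trans h')
  have hint : Integrable (fun ω => F ((ε ω - 1) • telegraph a₀ a₁ (fun k => e k ω) +
      ε ω • telegraph a₁ a₀ (fun k => e' k ω))) P' := by
    refine Integrable.of_bound (hF.measurable.comp_aemeasurable
      (aemeasurable_mixture he he' hε)).aestronglyMeasurable (|F 0| + (T + 0)) ?_
    filter_upwards [mixture_mem_lipPaths (a₀ := a₀) (a₁ := a₁) (e := e) (e' := e') hε h] with ω hω
    exact hFT.abs_le hω
  have hunion : (({ω | ε ω = 0} ∪ {ω | ε ω = 1} : Set Ω')) =ᵐ[P'] Set.univ :=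
    eventuallyEq_univ.2 (ae_eq_zero_or_one hε h)
  rw [← setIntegral_univ, ← setIntegral_congr_set hunion,
    setIntegral_union hd h1 hint.integrableOn hint.integrableOn,
    ← he.setIntegral_eq_mul_telegraphMean hε hind 0 (-1) a₀ a₁ hF,
    ← he'.setIntegral_eq_mul_telegraphMean hε hind' 1 1 a₁ a₀ hF]
  congr 1
  · refine setIntegral_congr_fun h0 fun ω hω => ?_
    have hω' : ε ω = 0 := hω
    simp only [hω', zero_smul, add_zero, zero_sub]
  · refine setIntegral_congr_fun h1 fun ω hω => ?_
    have hω' : ε ω = 1 := hω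
    simp only [hω', sub_self, zero_smul, zero_add]

end

theorem theorem4p2 (c₀ c₁ p₀ p₁ v₀ v₁ c₀' c₁' : ℝ)
    (hc₀ : 0 < c₀) (hc₁ : 0 < c₁) (hp₀ : 0 < p₀) (hp₀' : p₀ < 1) (hp₁ : 0 < p₁) (hp₁' : p₁ < 1)
    (hv₀ : v₀ = absorb p₀ p₁ p₀) (hv₁ : v₁ = absorb p₀ p₁ p₁)
    (hc₀' : c₀' = c₀ * v₀) (hc₁' : c₁' = c₁ * v₁)
    -- for every admissible time step, an order-two chain on some probability space
    {Ω : StepSize c₀ c₁ → Type*} [∀ δ, MeasurableSpace (Ω δ)]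
    (P : ∀ δ, Measure (Ω δ)) [∀ δ, IsProbabilityMeasure (P δ)]
    (Y : ∀ δ, ℕ → Ω δ → ℤ)
    (hY : ∀ δ, IsOrderTwoChain (pairMatrix c₀ c₁ p₀ p₁ δ.1) (Y δ) (P δ))
    -- two (possibly equal, possibly dependent) sequences driving the limit processes
    {Ω' : Type*} [MeasurableSpace Ω'] (P' : Measure Ω') [IsProbabilityMeasure P']
    (e e' : ℕ → Ω' → ℝ) (he : IsStdExpSequence e P') (he' : IsStdExpSequence e' P') :
    -- 1) equal first two increments
    ((∀ δ, ∀ᵐ ω ∂(P δ), Y δ 0 ω = -1 ∧ Y δ 1 ω = -1) →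
      TendstoInDistribution (fun δ ω => interpWalk δ.1 (fun t => Y δ t ω)) (stepToZero c₀ c₁)
        (fun ω => -telegraph c₀' c₁' (fun k => e k ω)) P P') ∧
    ((∀ δ, ∀ᵐ ω ∂(P δ), Y δ 0 ω = 1 ∧ Y δ 1 ω = 1) →
      TendstoInDistribution (fun δ ω => interpWalk δ.1 (fun t => Y δ t ω)) (stepToZero c₀ c₁)
        (fun ω => telegraph c₁' c₀' (fun k => e k ω)) P P') ∧
    -- 2) different first two increments
    (∀ ε : Ω' → ℝ, Measurable ε →
      IndepFun ε (fun ω k => e k ω) P' → IndepFun ε (fun ω k => e' k ω) P' →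
      ((∀ δ, ∀ᵐ ω ∂(P δ), Y δ 0 ω = 1 ∧ Y δ 1 ω = -1) →
        P'.real {ω | ε ω = 0} = v₁ → P'.real {ω | ε ω = 1} = 1 - v₁ →
        TendstoInDistribution (fun δ ω => interpWalk δ.1 (fun t => Y δ t ω)) (stepToZero c₀ c₁)
          (fun ω => (ε ω - 1) • telegraph c₀' c₁' (fun k => e k ω) +
            ε ω • telegraph c₁' c₀' (fun k => e' k ω)) P P') ∧
      ((∀ δ, ∀ᵐ ω ∂(P δ), Y δ 0 ω = -1 ∧ Y δ 1 ω = 1) →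
        P'.real {ω | ε ω = 1} = v₀ → P'.real {ω | ε ω = 0} = 1 - v₀ →
        TendstoInDistribution (fun δ ω => interpWalk δ.1 (fun t => Y δ t ω)) (stepToZero c₀ c₁)
          (fun ω => (ε ω - 1) • telegraph c₀' c₁' (fun k => e k ω) +
            ε ω • telegraph c₁' c₀' (fun k => e' k ω)) P P')) := by
  have key := fun i hi => @tendstoInDistribution_interpWalk _ _ _ _ _ _ _ _ hc₀ hc₁ hp₀ hp₀' hp₁
    hp₁' hv₀ hv₁ hc₀' hc₁' Ω _ P _ Y hY i hi Ω' _ P' _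
  refine ⟨fun hi => ?_, fun hi => ?_, fun ε hε hind hind' => ⟨fun hi h0 h1 => ?_,
    fun hi h1 h0 => ?_⟩⟩
  · have hZ : (fun ω => -telegraph c₀' c₁' fun k => e k ω) =
        fun ω => (-1 : ℝ) • telegraph c₀' c₁' fun k => e k ω := by simp
    rw [hZ]
    refine key 0 (fun δ => ?_) (he.aemeasurable_smul_telegraph _ _ _)
      (ae_of_all _ fun ω => smul_telegraph_mem_lipPaths (by simp) _)
      fun F T hF _ => he.integral_eq_telegraphMean _ _ _ hF
    filter_upwards [hi δ] with ω hω
    exact Prod.ext hω.1 hω.2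
  · have hZ : (fun ω => telegraph c₁' c₀' fun k => e k ω) =
        fun ω => (1 : ℝ) • telegraph c₁' c₀' fun k => e k ω := by simp
    rw [hZ]
    refine key 3 (fun δ => ?_) (he.aemeasurable_smul_telegraph _ _ _)
      (ae_of_all _ fun ω => smul_telegraph_mem_lipPaths (by simp) _)
      fun F T hF _ => he.integral_eq_telegraphMean _ _ _ hF
    filter_upwards [hi δ] with ω hω
    exact Prod.ext hω.1 hω.2
  · have hsum : P'.real {ω | ε ω = 0} + P'.real {ω | ε ω = 1} = 1 := by rw [h0, h1]; ring
    refine key 2 (fun δ => ?_) (aemeasurable_mixture he he' hε) (mixture_mem_lipPaths hε hsum)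
      fun F T hF hFT => ?_
    · filter_upwards [hi δ] with ω hω
      exact Prod.ext hω.1 hω.2
    · rw [integral_mixture he he' hε hind hind' hsum hF hFT, h0, h1]
      rfl
  · have hsum : P'.real {ω | ε ω = 0} + P'.real {ω | ε ω = 1} = 1 := by rw [h0, h1]; ring
    refine key 1 (fun δ => ?_) (aemeasurable_mixture he he' hε) (mixture_mem_lipPaths hε hsum)
      fun F T hF hFT => ?_
    · filter_upwards [hi δ] with ω hω
      exact Prod.ext hω.1 hω.2
    · rw [integral_mixture he he' hε hind hind' hsum hF hFT, h0, h1, add_comm]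
      rfl
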